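/- Let $\mathbb K=\mathbb R$ or $\mathbb C$, let $V,V'$ be locally convex topological $\mathbb K$-vector spaces with $V'$ Hausdorff, let $U\subset V$ be open and $f:U\to V'$ a map, and let $n\in\mathbb N_0$. Consider the following three conditions. **Full iteration, $C^n_{\mathbb K}$.** Put $U^{[1]}=\{(v_0,v_1;t,s)\in V^2\times\mathbb K^2 : v_0+tv_1\in U,\ v_0+sv_1\in U\}$. The map $f$ is of class $C^1_{\mathbb K}$ if the slope $$(v_0,v_1;t,s)\mapsto \frac{f(v_0+tv_1)-f(v_0+sv_1)}{t-s}\qquad(t\neq s)$$ extends to a continuous map $f^{[1]}:U^{[1]}\to V'$ (which is then unique). The map $f$ is of class $C^0_{\mathbb K}$ if it is continuous, and for $n\ge 1$ it is of class $C^n_{\mathbb K}$ if it is of class $C^1_{\mathbb K}$ and $f^{[1]}:U^{[1]}\to V'$ is of class $C^{n-1}_{\mathbb K}$, where $U^{[1]}$ is regarded as a subset of $V^2\times\mathbb K^2$. **Restricted iteration, $C_{\mathbb K,n}$.** For $(t,s)\in\mathbb K^2$ put $U_{(t,s)}=\{(v_0,v_1)\in V^2:(v_0,v_1;t,s)\in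 U^{[1]}\}$ and, if $f$ is of class $C^1_{\mathbb K}$, let $f_{(t,s)}:U_{(t,s)}\to V'\times V'$ be given by $f_{(t,s)}(v_0,v_1)=(w_0,w_1)$ with $w_1=f^{[1]}(v_0,v_1;t,s)$ and $w_0=f(v_0+tv_1)-t\,w_1$; thus $w_0+sw_1=f(v_0+sv_1)$ and $w_0+tw_1=f(v_0+tv_1)$. The map $f$ is of class $C_{\mathbb K,0}$ if it is continuous, and for $n\ge1$ it is of class $C_{\mathbb K,n}$ if it is of class $C^1_{\mathbb K}$, for all $(t_1,s_1)\in\mathbb K^2$ the map $f_{(t_1,s_1)}$ is of class $C_{\mathbb K,n-1}$, and the $n$-fold iterated map $(\ldots(f_{(t_1,s_1)})_{(t_2,s_2)}\ldots)_{(t_n,s_n)}(\mathbf v)$ is jointly continuous in the space and time variables $(\mathbf v;t_1,\dots,t_n,s_1,\dots,s_n)$, where $\mathbf v$ ranges over $(\ldots(U_{(t_1,s_1)})_{(t_2,s_2)}\ldots)_{(t_n,s_n)}\subset V^{2^n}$. **Keller's $C^n_c$.** For all $k\le n$ the iterated directional derivatives $d^kf(x;v_1,\dots,v_k)=(D_{v_k}\cdots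 D_{v_1}f)(x)$ exist for all $x\in U$ and $v_1,\dots,v_k\in V$, where $D_vg(x)=\lim_{0\ne t\to0,\ t\in\mathbb K}\frac{g(x+tv)-g(x)}{t}$, and the maps $d^kf:U\times V^k\to V'$ are continuous (for $k=0$: $f$ is continuous). Then $f$ is of class $C^n_{\mathbb K}$ if and only if it is of class $C^n_c$ in the sense of Keller, and $f$ is of class $C_{\mathbb K,n}$ if and only if it is of class $C^n_c$ in the sense of Keller. -/

import Mathlib

open Set Filter Topology

universe u v

noncomputable section

namespace DiffCalc

variable (𝕜 : Type) [Field 𝕜] [TopologicalSpace 𝕜]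

/-! Maps `f : U → W` on a subset `U` of `V` are written as functions `f : V → W` together with the set
`U`; none of the notions below depends on the values of `f` outside `U`. -/

section FirstOrder

variable {V : Type u} {W : Type v} [AddCommGroup V] [Module 𝕜 V] [TopologicalSpace V]
  [AddCommGroup W] [Module 𝕜 W] [TopologicalSpace W]

/-- The extended domain `U^[1]`: all `(v₀, v₁, t, s)` with `v₀ + t v₁ ∈ U` and `v₀ + s v₁ ∈ U`. -/
def slopeDomain (U : Set V) : Set (V × V × 𝕜 × 𝕜) :=
  {p | p.1 + p.2.2.1 • p.2.1 ∈ U ∧ p.1 + p.2.2.2 • p.2.1 ∈ U}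

/-- `F` is a continuous extension to `U^[1]` of the slope
`(f (v₀ + t v₁) - f (v₀ + s v₁)) / (t - s)`, which is given for `t ≠ s`. -/
def IsSlopeExtension (U : Set V) (f : V → W) (F : V × V × 𝕜 × 𝕜 → W) : Prop :=
  ContinuousOn F (slopeDomain 𝕜 U) ∧
    ∀ (v₀ v₁ : V) (t s : 𝕜), (v₀, v₁, t, s) ∈ slopeDomain 𝕜 U → t ≠ s →
      F (v₀, v₁, t, s) = (t - s)⁻¹ • (f (v₀ + t • v₁) - f (v₀ + s • v₁))

/-- `f : U → W` is of class `C¹`: its slope extends continuously to `U^[1]`. -/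
def IsC1 (U : Set V) (f : V → W) : Prop :=
  ∃ F : V × V × 𝕜 × 𝕜 → W, IsSlopeExtension 𝕜 U f F

open Classical in
/-- The extended slope `f^[1] : U^[1] → W` of a map of class `C¹` (on `U^[1]` it is unique when `U` is
open, `W` is Hausdorff and `𝕜` is not discrete); zero when `f` is not of class `C¹`. -/
def slopeMap (U : Set V) (f : V → W) : V × V × 𝕜 × 𝕜 → W :=
  if h : IsC1 𝕜 U f then h.choose else 0

variable {𝕜}

/-- The domain `U_{(t,s)}` with frozen time parameters `(t, s)`. -/
def frozenDomain (U : Set V) (t s : 𝕜) : Set (V × V) :=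
  {p | p.1 + t • p.2 ∈ U ∧ p.1 + s • p.2 ∈ U}

/-- The map `f_{(t,s)} : U_{(t,s)} → W × W`. Its second component is the extended slope `w₁`, and its
first component is `w₀ = f (v₀ + t v₁) - t w₁`, the solution of
`w₀ + s w₁ = f (v₀ + s v₁)`, `w₀ + t w₁ = f (v₀ + t v₁)`. -/
def frozenMap (U : Set V) (f : V → W) (t s : 𝕜) : V × V → W × W :=
  fun p => (f (p.1 + t • p.2) - t • slopeMap 𝕜 U f (p.1, p.2, t, s), slopeMap 𝕜 U f (p.1, p.2, t, s))

end FirstOrder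

/-- Full iteration: `f : U → W` is of class `Cⁿ`. It is continuous if `n = 0`; and for `n ≥ 1` it is of
class `C¹` and `f^[1] : U^[1] → W` is of class `Cⁿ⁻¹`. -/
def IsCFull : (n : ℕ) → {V : Type u} → {W : Type v} →
    [AddCommGroup V] → [Module 𝕜 V] → [TopologicalSpace V] →
    [AddCommGroup W] → [Module 𝕜 W] → [TopologicalSpace W] → Set V → (V → W) → Prop
  | 0, _, _, _, _, _, _, _, _, U, f => ContinuousOn f U
  | n + 1, _, _, _, _, _, _, _, _, U, f =>
      IsC1 𝕜 U f ∧ IsCFull n (slopeDomain 𝕜 U) (slopeMap 𝕜 U f)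

/-- The space of `2ⁿ` space variables obtained from `V` by `n`-fold iteration of `V ↦ V × V`. -/
def Iter (V : Type u) : ℕ → Type u
  | 0 => V
  | n + 1 => Iter (V × V) n

instance Iter.instTopologicalSpace : (n : ℕ) → (V : Type u) → [TopologicalSpace V] →
    TopologicalSpace (Iter V n)
  | 0, _, i => i
  | n + 1, V, _ => Iter.instTopologicalSpace n (V × V)

variable {𝕜}

/-- The restricted iterated domain
`(… (U_{(t₁,s₁)})_{(t₂,s₂)} …)_{(tₙ,sₙ)}`. -/
def iterDomain : (n : ℕ) → {V : Type u} → [AddCommGroup V] → [Module 𝕜 V] →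
    Set V → (Fin n → 𝕜) → (Fin n → 𝕜) → Set (Iter V n)
  | 0, _, _, _, U, _, _ => U
  | n + 1, _, _, _, U, t, s => iterDomain n (frozenDomain U (t 0) (s 0)) (Fin.tail t) (Fin.tail s)

/-- The restricted iterated map
`(… (f_{(t₁,s₁)})_{(t₂,s₂)} …)_{(tₙ,sₙ)}`. -/
def iterMap : (n : ℕ) → {V : Type u} → {W : Type v} →
    [AddCommGroup V] → [Module 𝕜 V] → [TopologicalSpace V] →
    [AddCommGroup W] → [Module 𝕜 W] → [TopologicalSpace W] →
    Set V → (V → W) → (Fin n → 𝕜) → (Fin n → 𝕜) → Iter V n → Iter W n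
  | 0, _, _, _, _, _, _, _, _, _, f, _, _ => f
  | n + 1, _, _, _, _, _, _, _, _, U, f, t, s =>
      iterMap n (frozenDomain U (t 0) (s 0)) (frozenMap U f (t 0) (s 0)) (Fin.tail t) (Fin.tail s)

variable (𝕜)

/-- Restricted iteration: `f : U → W` is continuous if `n = 0`; and for `n ≥ 1` it is of class `C¹`, all
`f_{(t,s)}` satisfy the condition of order `n - 1`, and the `n`-fold iterated map is jointly continuous in
the space and time variables. -/
def IsCRestricted : (n : ℕ) → {V : Type u} → {W : Type v} →
    [AddCommGroup V] → [Module 𝕜 V] → [TopologicalSpace V] →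
    [AddCommGroup W] → [Module 𝕜 W] → [TopologicalSpace W] → Set V → (V → W) → Prop
  | 0, _, _, _, _, _, _, _, _, U, f => ContinuousOn f U
  | n + 1, V, _, _, _, _, _, _, _, U, f =>
      IsC1 𝕜 U f ∧
      (∀ t s : 𝕜, IsCRestricted n (frozenDomain U t s) (frozenMap U f t s)) ∧
      ContinuousOn
        (fun p : Iter V (n + 1) × (Fin (n + 1) → 𝕜) × (Fin (n + 1) → 𝕜) =>
          iterMap (n + 1) U f p.2.1 p.2.2 p.1)
        {p | p.1 ∈ iterDomain (n + 1) U p.2.1 p.2.2}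

section Keller

variable {V : Type u} {W : Type v} [AddCommGroup V] [Module 𝕜 V] [TopologicalSpace V]
  [AddCommGroup W] [Module 𝕜 W] [TopologicalSpace W]

/-- `w` is the directional derivative over `𝕜` of `f` at `x` in direction `v`. -/
def HasDirDeriv (f : V → W) (w : W) (x v : V) : Prop :=
  Tendsto (fun t : 𝕜 => t⁻¹ • (f (x + t • v) - f x)) (𝓝[≠] 0) (𝓝 w)

/-- Keller's `Cⁿ_c`: the iterated directional derivatives
`dᵏf (x; v₁, …, v_k) = (D_{v_k} ⋯ D_{v₁} f) (x)` exist for all `k ≤ n`, `x ∈ U` and `v₁, …, v_k ∈ V`, and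
each `dᵏf : U × Vᵏ → W` is jointly continuous. -/
def IsCKeller (n : ℕ) (U : Set V) (f : V → W) : Prop :=
  ∃ d : (k : ℕ) → V → (Fin k → V) → W,
    (∀ x ∈ U, d 0 x Fin.elim0 = f x) ∧
    (∀ k < n, ∀ x ∈ U, ∀ (v : Fin k → V) (w : V),
      HasDirDeriv 𝕜 (fun y => d k y v) (d (k + 1) x (Fin.snoc v w)) x w) ∧
    ∀ k ≤ n, ContinuousOn (fun p : V × (Fin k → V) => d k p.1 p.2) (U ×ˢ univ)

end Keller

end DiffCalc

end

/-!
All three conditions are compared with a fourth one, Bastiani's class `IsCBastiani`: `f` is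
continuous, its directional derivatives exist, and `df : U × V → V'` is again of class `Cⁿ⁻¹`. This
class obeys the usual calculus (chain rule, products, locality), because a jointly continuous `df`
completes the slope of `f` continuously on the diagonal `t = s`, by the mean value theorem in the
locally convex space `V'` (`isSlopeExtension_completedSlope`).

* Full and restricted iteration both imply Bastiani's condition by induction, since `df` is the
  restriction of `f^[1]` to `t = s = 0`, hence the second component of `f_{(0,0)}`.
* Bastiani's condition implies Keller's, since `dᵏ⁺¹f` is a restriction of `dᵏ(df)`. Conversely the
  maps `dᵏf` of Keller are multilinear in the directions (`map_update_of_keller`), which gives their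
  total derivatives on `U × Vᵏ` in terms of `dᵏ⁺¹f` and `dᵏf` (`isCBastiani_of_keller`).
* The main point is that `f^[1]` is of class `Cⁿ` if `f` is of class `Cⁿ⁺¹`
  (`IsCBastiani.slopeMap`). Off the diagonal this is the chain rule. Near the diagonal, with
  `r = t - s`, the slope is `∫₀¹ df (v₀ + (s + u r) v₁; v₁) du`. As `V'` need not be complete,
  integrals are only used after composition with real functionals, and it has to be seen that the
  derivatives of such averages have values in `V'` itself. For `r ≠ 0` this holds because the slope is
  differentiable there; for `r = 0` the integrands are multiples of `uʲ`, whose integrals are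
  explicit. Keeping track of averages with weights `uʲ` makes the induction close
  (`IsRadialAverage.isCBastiani`).
* With this, Bastiani's condition implies full iteration by induction. For restricted iteration, the
  same induction is run for maps depending on parameters, the time variables of earlier steps being
  added to the parameters (`IsCBastiani.continuousOn_iterMap`); this yields the joint continuity.
-/

universe w

namespace DiffCalc

variable {𝕜 : Type} [RCLike 𝕜]

/-! ### Continuous real functionals and closed convex sets -/

section Dual

variable {W : Type v} [AddCommGroup W] [Module 𝕜 W] [Module ℝ W] [IsScalarTower ℝ 𝕜 W]

variable (𝕜) in
theorem ofReal_smul (r : ℝ) (y : W) : (r : 𝕜) • y = r • y := algebraMap_smul 𝕜 r y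

theorem smul_real_smul_comm (c : 𝕜) (r : ℝ) (y : W) : c • r • y = r • c • y := by
  rw [← ofReal_smul 𝕜 r y, ← ofReal_smul 𝕜 r (c • y), smul_comm]

variable [TopologicalSpace W] [ContinuousSMul 𝕜 W]

/-- The real functional `y ↦ ℓ (c • y)`, for a scalar `c` of the field `𝕜`. -/
noncomputable def scaledDual (c : 𝕜) (ℓ : W →L[ℝ] ℝ) : W →L[ℝ] ℝ where
  toFun y := ℓ (c • y)
  map_add' x y := by rw [smul_add, map_add]
  map_smul' r y := by rw [smul_real_smul_comm, map_smul]; rfl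
  cont := ℓ.continuous.comp (continuous_const_smul c)

@[simp] theorem scaledDual_apply (c : 𝕜) (ℓ : W →L[ℝ] ℝ) (y : W) :
    scaledDual c ℓ y = ℓ (c • y) := rfl

end Dual

section Convex

variable {W : Type v} [AddCommGroup W] [TopologicalSpace W] [IsTopologicalAddGroup W]
  [Module ℝ W] [ContinuousSMul ℝ W] [LocallyConvexSpace ℝ W]

theorem exists_isClosed_convex_mem_nhds_subset {w : W} {O : Set W} (hO : O ∈ 𝓝 w) :
    ∃ C ∈ 𝓝 w, IsClosed C ∧ Convex ℝ C ∧ C ⊆ O := by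
  obtain ⟨K, hK, hKc, hKO⟩ := exists_mem_nhds_isClosed_subset hO
  obtain ⟨A, hA, hAK⟩ := (LocallyConvexSpace.convex_basis (𝕜 := ℝ) w).mem_iff.1 hK
  exact ⟨closure A, mem_of_superset hA.1 subset_closure, isClosed_closure, hA.2.closure,
    (closure_minimal hAK hKc).trans hKO⟩

theorem mem_of_forall_dual_le {C : Set W} (hC : IsClosed C) (hC' : Convex ℝ C) {x : W}
    (h : ∀ (ℓ : W →L[ℝ] ℝ) (c : ℝ), (∀ y ∈ C, ℓ y ≤ c) → ℓ x ≤ c) : x ∈ C := by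
  by_contra hx
  obtain ⟨ℓ, c, h1, h2⟩ := geometric_hahn_banach_closed_point hC' hC hx
  exact absurd (h ℓ c fun y hy => (h1 y hy).le) (not_le.2 h2)

theorem eq_of_forall_dual_eq [T2Space W] {x y : W} (h : ∀ ℓ : W →L[ℝ] ℝ, ℓ x = ℓ y) : x = y := by
  by_contra hxy
  obtain ⟨ℓ, hℓ⟩ := geometric_hahn_banach_point_point hxy
  exact hℓ.ne (h ℓ)

end Convex

/-! ### Directional derivatives -/

section DirDeriv

variable {V : Type u} [AddCommGroup V] [Module 𝕜 V] {W : Type v} [AddCommGroup W] [Module 𝕜 W]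
  [TopologicalSpace W]

theorem HasDirDeriv.unique [T2Space W] {f : V → W} {w w' : W} {x v : V}
    (h : HasDirDeriv 𝕜 f w x v) (h' : HasDirDeriv 𝕜 f w' x v) : w = w' :=
  tendsto_nhds_unique h h'

theorem eventually_add_smul_mem [TopologicalSpace V] [IsTopologicalAddGroup V]
    [ContinuousSMul 𝕜 V] {U : Set V}
    (hU : IsOpen U) {x : V} (hx : x ∈ U) (v : V) : ∀ᶠ t : 𝕜 in 𝓝 0, x + t • v ∈ U := by
  have : Tendsto (fun t : 𝕜 => x + t • v) (𝓝 0) (𝓝 x) := by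
    have : ContinuousAt (fun t : 𝕜 => x + t • v) 0 := by fun_prop
    simpa [ContinuousAt] using this
  exact this (hU.mem_nhds hx)

theorem HasDirDeriv.congr_of_eqOn [TopologicalSpace V] [IsTopologicalAddGroup V]
    [ContinuousSMul 𝕜 V] {U : Set V}
    (hU : IsOpen U) {f g : V → W} (hfg : EqOn f g U) {w : W} {x v : V} (hx : x ∈ U)
    (h : HasDirDeriv 𝕜 f w x v) : HasDirDeriv 𝕜 g w x v := by
  refine Tendsto.congr' ?_ h
  filter_upwards [(eventually_add_smul_mem hU hx v).filter_mono nhdsWithin_le_nhds] with t ht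
  rw [hfg ht, hfg hx]

theorem HasDirDeriv.const (c : W) (x v : V) : HasDirDeriv 𝕜 (fun _ => c) (0 : W) x v := by
  simpa [HasDirDeriv] using tendsto_const_nhds

theorem HasDirDeriv.zero_dir (f : V → W) (x : V) : HasDirDeriv 𝕜 f (0 : W) x 0 := by
  simpa [HasDirDeriv] using tendsto_const_nhds

theorem HasDirDeriv.smul_dir [ContinuousSMul 𝕜 W] {f : V → W} {w : W} {x v : V}
    (h : HasDirDeriv 𝕜 f w x v) (c : 𝕜) : HasDirDeriv 𝕜 f (c • w) x (c • v) := by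
  rcases eq_or_ne c 0 with rfl | hc
  · simpa using HasDirDeriv.zero_dir f x
  have hlim : Tendsto (fun t : 𝕜 => t * c) (𝓝[≠] 0) (𝓝[≠] 0) := by
    refine tendsto_nhdsWithin_iff.2 ⟨?_, ?_⟩
    · have : ContinuousAt (fun t : 𝕜 => t * c) 0 := by fun_prop
      simpa using this.tendsto.mono_left nhdsWithin_le_nhds
    · filter_upwards [self_mem_nhdsWithin] with t ht
      exact mul_ne_zero ht hc
  refine Tendsto.congr' ?_ ((h.comp hlim).const_smul c)
  filter_upwards with t
  simp only [Function.comp_apply, smul_smul, mul_inv_rev]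
  rw [← mul_assoc, mul_inv_cancel₀ hc, one_mul]

theorem HasDirDeriv.add [IsTopologicalAddGroup W] {f g : V → W} {w w' : W} {x v : V}
    (h : HasDirDeriv 𝕜 f w x v) (h' : HasDirDeriv 𝕜 g w' x v) :
    HasDirDeriv 𝕜 (fun y => f y + g y) (w + w') x v := by
  refine Tendsto.congr (fun t => ?_) (Tendsto.add h h')
  rw [← smul_add]
  congr 1
  beta_reduce
  abel

theorem HasDirDeriv.const_smul [ContinuousSMul 𝕜 W] {f : V → W} {w : W} {x v : V}
    (h : HasDirDeriv 𝕜 f w x v) (c : 𝕜) : HasDirDeriv 𝕜 (fun y => c • f y) (c • w) x v := by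
  refine Tendsto.congr (fun t => ?_) (Tendsto.const_smul h c)
  rw [← smul_sub, smul_comm]

theorem HasDirDeriv.prodMk {W' : Type*} [AddCommGroup W'] [Module 𝕜 W'] [TopologicalSpace W']
    {f : V → W} {g : V → W'} {w : W} {w' : W'} {x v : V} (h : HasDirDeriv 𝕜 f w x v)
    (h' : HasDirDeriv 𝕜 g w' x v) : HasDirDeriv 𝕜 (fun y => (f y, g y)) (w, w') x v :=
  Tendsto.prodMk_nhds h h'

/-- Along a real line, composition with a real functional turns a directional derivative into an
ordinary derivative. -/
theorem HasDirDeriv.hasDerivAt_dual [Module ℝ W] [IsScalarTower ℝ 𝕜 W] {f : V → W} {w : W}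
    {x v : V} {u : ℝ} (h : HasDirDeriv 𝕜 f w (x + (u : 𝕜) • v) v) (ℓ : W →L[ℝ] ℝ) :
    HasDerivAt (fun e : ℝ => ℓ (f (x + (e : 𝕜) • v))) (ℓ w) u := by
  rw [hasDerivAt_iff_tendsto_slope_zero]
  have hlim : Tendsto (fun t : ℝ => (t : 𝕜)) (𝓝[≠] 0) (𝓝[≠] 0) := by
    refine tendsto_nhdsWithin_iff.2 ⟨?_, ?_⟩
    · have : ContinuousAt (fun t : ℝ => (t : 𝕜)) 0 := RCLike.continuous_ofReal.continuousAt
      simpa [ContinuousAt] using this.tendsto.mono_left nhdsWithin_le_nhds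
    · filter_upwards [self_mem_nhdsWithin] with t ht
      simpa using ht
  refine Tendsto.congr (fun t => ?_) ((ℓ.continuous.tendsto w).comp (h.comp hlim))
  simp only [Function.comp_apply]
  rw [← RCLike.ofReal_inv, ofReal_smul 𝕜, map_smul, map_sub, add_assoc, ← add_smul,
    RCLike.ofReal_add]

end DirDeriv

/-! ### The mean value theorem -/

section MeanValue

variable {V : Type u} [AddCommGroup V] [Module 𝕜 V] {W : Type v} [AddCommGroup W] [Module 𝕜 W]
  [TopologicalSpace W] [IsTopologicalAddGroup W] [ContinuousSMul 𝕜 W] [Module ℝ W]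
  [IsScalarTower ℝ 𝕜 W] [ContinuousSMul ℝ W] [LocallyConvexSpace ℝ W]

/-- If all derivatives in direction `v` along the segment from `x` to `x + t • v` lie in a closed
convex set, so does the difference quotient. Derivatives are taken weakly, that is, after
composition with real functionals. -/
theorem slope_mem_of_hasDerivAt_dual {f : V → W} {x v : V} {t : 𝕜} (ht : t ≠ 0) {δ : ℝ → W}
    {C : Set W} (hC : IsClosed C) (hC' : Convex ℝ C)
    (hd : ∀ u ∈ Icc (0 : ℝ) 1, ∀ ℓ : W →L[ℝ] ℝ,
      HasDerivAt (fun e : ℝ => ℓ (f (x + (e : 𝕜) • t • v))) (ℓ (t • δ u)) u)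
    (hδ : ∀ u ∈ Icc (0 : ℝ) 1, δ u ∈ C) : t⁻¹ • (f (x + t • v) - f x) ∈ C := by
  refine mem_of_forall_dual_le hC hC' fun ℓ c hc => ?_
  have key : ∀ u ∈ Icc (0 : ℝ) 1, HasDerivAt
      (fun e : ℝ => scaledDual t⁻¹ ℓ (f (x + (e : 𝕜) • t • v))) (ℓ (δ u)) u := by
    intro u hu
    have h' := hd u hu (scaledDual t⁻¹ ℓ)
    rwa [scaledDual_apply, smul_smul, inv_mul_cancel₀ ht, one_smul] at h'
  obtain ⟨u, hu, hu'⟩ := exists_hasDerivAt_eq_slope _ _ zero_lt_one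
    (fun u hu => (key u hu).continuousAt.continuousWithinAt)
    (fun u hu => key u (Ioo_subset_Icc_self hu))
  have := hc _ (hδ u (Ioo_subset_Icc_self hu))
  rw [hu'] at this
  simpa [smul_sub] using this

theorem tendsto_slope_of_dual {ι : Type*} {l : Filter ι} {f : V → W} {x v : ι → V} {t : ι → 𝕜}
    {δ : ι → ℝ → W} {w : W} (ht : ∀ᶠ i in l, t i ≠ 0)
    (hd : ∀ᶠ i in l, ∀ u ∈ Icc (0 : ℝ) 1, ∀ ℓ : W →L[ℝ] ℝ,
      HasDerivAt (fun e : ℝ => ℓ (f (x i + (e : 𝕜) • t i • v i))) (ℓ (t i • δ i u)) u)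
    (hδ : ∀ O ∈ 𝓝 w, ∀ᶠ i in l, ∀ u ∈ Icc (0 : ℝ) 1, δ i u ∈ O) :
    Tendsto (fun i => (t i)⁻¹ • (f (x i + t i • v i) - f (x i))) l (𝓝 w) := by
  intro O hO
  obtain ⟨C, hCw, hC, hC', hCO⟩ := exists_isClosed_convex_mem_nhds_subset hO
  rw [Filter.mem_map]
  filter_upwards [ht, hd, hδ C hCw] with i h1 h2 h3
  exact hCO (slope_mem_of_hasDerivAt_dual h1 hC hC' h2 h3)

theorem tendsto_slope {ι : Type*} {l : Filter ι} {f : V → W} {x v : ι → V} {t : ι → 𝕜}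
    {δ : ι → ℝ → W} {w : W} (ht : ∀ᶠ i in l, t i ≠ 0)
    (hd : ∀ᶠ i in l, ∀ u ∈ Icc (0 : ℝ) 1,
      HasDirDeriv 𝕜 f (δ i u) (x i + ((u : 𝕜) * t i) • v i) (v i))
    (hδ : ∀ O ∈ 𝓝 w, ∀ᶠ i in l, ∀ u ∈ Icc (0 : ℝ) 1, δ i u ∈ O) :
    Tendsto (fun i => (t i)⁻¹ • (f (x i + t i • v i) - f (x i))) l (𝓝 w) := by
  refine tendsto_slope_of_dual ht ?_ hδ
  filter_upwards [hd] with i hi u hu ℓ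
  have h := (hi u hu).smul_dir (t i)
  rw [mul_smul] at h
  exact h.hasDerivAt_dual ℓ

theorem norm_ofReal_mul_le {u : ℝ} (hu : u ∈ Icc (0 : ℝ) 1) (t : 𝕜) : ‖(u : 𝕜) * t‖ ≤ ‖t‖ := by
  rw [norm_mul, RCLike.norm_ofReal, abs_of_nonneg hu.1]
  exact mul_le_of_le_one_left (norm_nonneg _) hu.2

theorem eventually_forall_add_smul_mem [TopologicalSpace V] [IsTopologicalAddGroup V]
    [ContinuousSMul 𝕜 V] {x : V} (v v' : V) {O : Set V} (hO : O ∈ 𝓝 x) :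
    ∀ᶠ t : 𝕜 in 𝓝[≠] 0, ∀ u ∈ Icc (0 : ℝ) 1, x + t • v' + ((u : 𝕜) * t) • v ∈ O := by
  have hc : ContinuousAt (fun p : 𝕜 × 𝕜 => x + p.1 • v' + p.2 • v) (0, 0) := by fun_prop
  have hc' := hc.preimage_mem_nhds (t := O) (by simpa using hO)
  obtain ⟨ε, hε, hball⟩ := Metric.mem_nhds_iff.1 hc'
  filter_upwards [nhdsWithin_le_nhds (Metric.ball_mem_nhds (0 : 𝕜) hε)] with t ht u hu
  refine hball (show (t, (u : 𝕜) * t) ∈ _ from ?_)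
  rw [mem_ball_zero_iff] at ht
  rw [show ((0 : 𝕜), (0 : 𝕜)) = 0 from rfl, mem_ball_zero_iff, Prod.norm_def]
  exact max_lt ht ((norm_ofReal_mul_le hu t).trans_lt ht)

/-- Directional derivatives are additive in the direction, provided that one of the two exists near
the point and is continuous there. -/
theorem HasDirDeriv.add_dir [TopologicalSpace V] [IsTopologicalAddGroup V]
    [ContinuousSMul 𝕜 V] {f : V → W}
    {δ : V → W} {w : W} {x v v' : V}
    (h : ∀ᶠ y in 𝓝 x, HasDirDeriv 𝕜 f (δ y) y v) (hδ : ContinuousAt δ x)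
    (h' : HasDirDeriv 𝕜 f w x v') : HasDirDeriv 𝕜 f (δ x + w) x (v + v') := by
  have h1 : Tendsto (fun t : 𝕜 => t⁻¹ • (f (x + t • v' + t • v) - f (x + t • v'))) (𝓝[≠] 0)
      (𝓝 (δ x)) :=
    tendsto_slope (x := fun t : 𝕜 => x + t • v') (v := fun _ => v)
      (δ := fun t u => δ (x + t • v' + ((u : 𝕜) * t) • v)) self_mem_nhdsWithin
      (eventually_forall_add_smul_mem v v' h)
      (fun O hO => eventually_forall_add_smul_mem v v' (hδ hO))
  refine Tendsto.congr (fun t => ?_) (h1.add h')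
  rw [← smul_add, smul_add t v v', add_comm (t • v), ← add_assoc]
  congr 1
  abel

theorem HasDirDeriv.sum_dir [TopologicalSpace V] [IsTopologicalAddGroup V]
    [ContinuousSMul 𝕜 V] {ι : Type*} (s : Finset ι) {f : V → W}
    {δ : ι → V → W} {x : V} {v : ι → V}
    (h : ∀ i, ∀ᶠ y in 𝓝 x, HasDirDeriv 𝕜 f (δ i y) y (v i)) (hδ : ∀ i, ContinuousAt (δ i) x) :
    HasDirDeriv 𝕜 f (∑ i ∈ s, δ i x) x (∑ i ∈ s, v i) := by
  classical
  induction s using Finset.induction_on with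
  | empty => simpa using HasDirDeriv.zero_dir f x
  | insert i s hi ih =>
    rw [Finset.sum_insert hi, Finset.sum_insert hi]
    exact HasDirDeriv.add_dir (h i) (hδ i) ih

/-- A map all of whose compositions with real functionals have real directional derivatives given by
a continuous `Δ` into `W` has the directional derivative `Δ` itself. -/
theorem hasDirDeriv_of_dual [TopologicalSpace V] [IsTopologicalAddGroup V] [ContinuousSMul 𝕜 V]
    {U : Set V} (hU : IsOpen U) {f : V → W} {Δ : V × V → W} (hΔ : ContinuousOn Δ (U ×ˢ univ))
    (hsmul : ∀ x ∈ U, ∀ v, ∀ c : 𝕜, Δ (x, c • v) = c • Δ (x, v))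
    (hd : ∀ x ∈ U, ∀ v, ∀ ℓ : W →L[ℝ] ℝ,
      HasDerivAt (fun e : ℝ => ℓ (f (x + (e : 𝕜) • v))) (ℓ (Δ (x, v))) 0)
    {x : V} (hx : x ∈ U) (v : V) : HasDirDeriv 𝕜 f (Δ (x, v)) x v := by
  have hΔ' : ContinuousAt (fun y => Δ (y, v)) x :=
    ContinuousAt.comp (g := Δ)
      (hΔ.continuousAt ((hU.prod isOpen_univ).mem_nhds ⟨hx, mem_univ _⟩)) (by fun_prop)
  have hsmall : ∀ O ∈ 𝓝 x, ∀ᶠ t : 𝕜 in 𝓝[≠] 0, ∀ u ∈ Icc (0 : ℝ) 1,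
      x + ((u : 𝕜) * t) • v ∈ O := fun O hO => by
    simpa using eventually_forall_add_smul_mem (𝕜 := 𝕜) v 0 hO
  refine tendsto_slope_of_dual (x := fun _ => x) (v := fun _ => v)
      (δ := fun t u => Δ (x + ((u : 𝕜) * t) • v, v)) self_mem_nhdsWithin ?_
      (fun O hO => hsmall _ (hΔ' hO))
  filter_upwards [hsmall U (hU.mem_nhds hx)] with t ht u hu ℓ
  have h := hd _ (ht u hu) (t • v) ℓ
  rw [hsmul _ (ht u hu)] at h
  rw [← sub_self u] at h
  refine (h.comp_sub_const u u).congr_of_eventuallyEq (.of_forall fun e => ?_)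
  beta_reduce
  rw [mul_smul, add_assoc, ← add_smul, RCLike.ofReal_sub, add_sub_cancel]

end MeanValue

/-! ### Extended slopes -/

section Slope

variable {V : Type u} [AddCommGroup V] [Module 𝕜 V] [TopologicalSpace V]
  [IsTopologicalAddGroup V] [ContinuousSMul 𝕜 V]

theorem isOpen_slopeDomain {U : Set V} (hU : IsOpen U) : IsOpen (slopeDomain 𝕜 U) := by
  refine IsOpen.inter (hU.preimage ?_) (hU.preimage ?_) <;> fun_prop

theorem isOpen_frozenDomain {U : Set V} (hU : IsOpen U) (t s : 𝕜) :
    IsOpen (frozenDomain U t s) := by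
  refine IsOpen.inter (hU.preimage ?_) (hU.preimage ?_) <;> fun_prop

variable {W : Type v} [AddCommGroup W] [Module 𝕜 W] [TopologicalSpace W]

open Classical in
/-- The slope of `f`, completed on the diagonal `t = s` by a candidate `δ` for the derivative. -/
noncomputable def completedSlope (f : V → W) (δ : V × V → W) (p : V × V × 𝕜 × 𝕜) : W :=
  if p.2.2.1 = p.2.2.2 then δ (p.1 + p.2.2.1 • p.2.1, p.2.1)
  else (p.2.2.1 - p.2.2.2)⁻¹ • (f (p.1 + p.2.2.1 • p.2.1) - f (p.1 + p.2.2.2 • p.2.1))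

/-- A continuous map with jointly continuous directional derivatives is of class `C¹`: by the mean
value theorem, the slope completed by the derivative is continuous on the diagonal. -/
theorem isSlopeExtension_completedSlope [IsTopologicalAddGroup W] [ContinuousSMul 𝕜 W]
    [Module ℝ W] [IsScalarTower ℝ 𝕜 W] [ContinuousSMul ℝ W] [LocallyConvexSpace ℝ W]
    {U : Set V} (hU : IsOpen U) {f : V → W} {δ : V × V → W} (hf : ContinuousOn f U)
    (hd : ∀ x ∈ U, ∀ v, HasDirDeriv 𝕜 f (δ (x, v)) x v) (hδ : ContinuousOn δ (U ×ˢ univ)) :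
    IsSlopeExtension 𝕜 U f (completedSlope f δ) := by
  refine ⟨?_, fun v₀ v₁ t s _ hts => by simp [completedSlope, hts]⟩
  rintro ⟨x, v, t, s⟩ ⟨hpt, hps⟩
  refine ContinuousAt.continuousWithinAt ?_
  simp only at hpt hps
  by_cases hts : t = s
  · subst hts
    have hval : completedSlope f δ (x, v, t, t) = δ (x + t • v, v) := by simp [completedSlope]
    rw [ContinuousAt, hval]
    have hδ' : ContinuousAt δ (x + t • v, v) :=
      hδ.continuousAt ((hU.prod isOpen_univ).mem_nhds ⟨hpt, mem_univ _⟩)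
    refine Tendsto.if ?_ ?_
    · refine Tendsto.mono_left ?_ inf_le_left
      exact hδ'.tendsto.comp (ContinuousAt.tendsto (x := (x, v, t, t))
        (f := fun p : V × V × 𝕜 × 𝕜 => (p.1 + p.2.2.1 • p.2.1, p.2.1)) (by fun_prop))
    · -- the segment between the two evaluation points stays near the limit point
      have hsmall : ∀ O ∈ 𝓝 (x + t • v, v), ∀ᶠ p : V × V × 𝕜 × 𝕜 in
          𝓝 (x, v, t, t) ⊓ 𝓟 {p | ¬ p.2.2.1 = p.2.2.2}, ∀ u ∈ Icc (0 : ℝ) 1,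
          (p.1 + p.2.2.2 • p.2.1 + ((u : 𝕜) * (p.2.2.1 - p.2.2.2)) • p.2.1, p.2.1) ∈ O := by
        intro O hO
        have hc : ContinuousAt (fun q : (V × V × 𝕜) × 𝕜 =>
            (q.1.1 + q.1.2.2 • q.1.2.1 + q.2 • q.1.2.1, q.1.2.1)) ((x, v, t), 0) := by fun_prop
        have hc' := hc.preimage_mem_nhds (t := O) (by simpa using hO)
        rw [nhds_prod_eq] at hc'
        obtain ⟨A, hA, B, hB, hAB⟩ := mem_prod_iff.1 hc'
        obtain ⟨ε, hε, hball⟩ := Metric.mem_nhds_iff.1 hB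
        have h1 : ∀ᶠ p : V × V × 𝕜 × 𝕜 in 𝓝 (x, v, t, t), (p.1, p.2.1, p.2.2.2) ∈ A :=
          (ContinuousAt.preimage_mem_nhds (x := (x, v, t, t))
            (f := fun p : V × V × 𝕜 × 𝕜 => (p.1, p.2.1, p.2.2.2)) (by fun_prop) hA)
        have h2 : ∀ᶠ p : V × V × 𝕜 × 𝕜 in 𝓝 (x, v, t, t),
            p.2.2.1 - p.2.2.2 ∈ Metric.ball (0 : 𝕜) ε :=
          (ContinuousAt.preimage_mem_nhds (x := (x, v, t, t))
            (f := fun p : V × V × 𝕜 × 𝕜 => p.2.2.1 - p.2.2.2) (by fun_prop)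
            (by simpa using Metric.ball_mem_nhds (0 : 𝕜) hε))
        filter_upwards [h1.filter_mono inf_le_left, h2.filter_mono inf_le_left] with p hp1 hp2 u hu
        refine hAB (show ((p.1, p.2.1, p.2.2.2), (u : 𝕜) * (p.2.2.1 - p.2.2.2)) ∈ A ×ˢ B from
          ⟨hp1, hball ?_⟩)
        rw [mem_ball_zero_iff] at hp2 ⊢
        exact (norm_ofReal_mul_le hu _).trans_lt hp2
      have := tendsto_slope (𝕜 := 𝕜) (f := f) (w := δ (x + t • v, v))
        (l := 𝓝 (x, v, t, t) ⊓ 𝓟 {p | ¬ p.2.2.1 = p.2.2.2})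
        (x := fun p : V × V × 𝕜 × 𝕜 => p.1 + p.2.2.2 • p.2.1) (v := fun p => p.2.1)
        (t := fun p => p.2.2.1 - p.2.2.2)
        (δ := fun p u => δ
          (p.1 + p.2.2.2 • p.2.1 + ((u : 𝕜) * (p.2.2.1 - p.2.2.2)) • p.2.1, p.2.1))
        (by filter_upwards [mem_inf_of_right (mem_principal_self _)] with p hp
            exact sub_ne_zero.2 hp)
        (by
          filter_upwards [hsmall _ ((hU.prod isOpen_univ).mem_nhds ⟨hpt, mem_univ _⟩)]
            with p hp u hu
          exact hd _ (hp u hu).1 _)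
        (fun O hO => hsmall _ (hδ' hO))
      refine this.congr fun p => ?_
      rw [add_assoc, ← add_smul, add_sub_cancel]
  · have hne : ∀ᶠ p : V × V × 𝕜 × 𝕜 in 𝓝 (x, v, t, s), p.2.2.1 - p.2.2.2 ≠ 0 :=
      ContinuousAt.eventually_ne (by fun_prop) (sub_ne_zero.2 hts)
    have hev : (fun p : V × V × 𝕜 × 𝕜 => (p.2.2.1 - p.2.2.2)⁻¹ •
        (f (p.1 + p.2.2.1 • p.2.1) - f (p.1 + p.2.2.2 • p.2.1))) =ᶠ[𝓝 (x, v, t, s)]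
        completedSlope f δ := by
      filter_upwards [hne] with p hp
      simp [completedSlope, sub_ne_zero.1 hp]
    refine ContinuousAt.congr ?_ hev
    have hft : ContinuousAt (fun p : V × V × 𝕜 × 𝕜 => f (p.1 + p.2.2.1 • p.2.1)) (x, v, t, s) :=
      ContinuousAt.comp (g := f) (hf.continuousAt (hU.mem_nhds hpt)) (by fun_prop)
    have hfs : ContinuousAt (fun p : V × V × 𝕜 × 𝕜 => f (p.1 + p.2.2.2 • p.2.1)) (x, v, t, s) :=
      ContinuousAt.comp (g := f) (hf.continuousAt (hU.mem_nhds hps)) (by fun_prop)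
    refine ContinuousAt.smul (ContinuousAt.inv₀ (by fun_prop) (sub_ne_zero.2 hts)) (hft.sub hfs)

theorem IsSlopeExtension.hasDirDeriv {U : Set V} (hU : IsOpen U) {f : V → W}
    {F : V × V × 𝕜 × 𝕜 → W} (h : IsSlopeExtension 𝕜 U f F) {x : V} (hx : x ∈ U) (v : V) :
    HasDirDeriv 𝕜 f (F (x, v, 0, 0)) x v := by
  have hF : ContinuousAt F (x, v, 0, 0) :=
    h.1.continuousAt ((isOpen_slopeDomain hU).mem_nhds (by simp [slopeDomain, hx]))
  have hlim : Tendsto (fun t : 𝕜 => F (x, v, t, 0)) (𝓝[≠] 0) (𝓝 (F (x, v, 0, 0))) :=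
    (hF.tendsto.comp (ContinuousAt.tendsto (x := (0 : 𝕜))
      (f := fun t : 𝕜 => (x, v, t, (0 : 𝕜))) (by fun_prop))).mono_left nhdsWithin_le_nhds
  refine hlim.congr' ?_
  filter_upwards [self_mem_nhdsWithin,
    (eventually_add_smul_mem hU hx v).filter_mono nhdsWithin_le_nhds] with t ht hxt
  rw [h.2 x v t 0 ⟨hxt, by simpa using hx⟩ ht]
  simp

theorem IsSlopeExtension.continuousOn [IsTopologicalAddGroup W] {U : Set V} (hU : IsOpen U)
    {f : V → W} {F : V × V × 𝕜 × 𝕜 → W} (h : IsSlopeExtension 𝕜 U f F) : ContinuousOn f U := by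
  intro x hx
  refine ContinuousAt.continuousWithinAt ?_
  have hF : ContinuousAt F (x, 0, 1, 0) :=
    h.1.continuousAt ((isOpen_slopeDomain hU).mem_nhds (by simp [slopeDomain, hx]))
  have hF0 : F (x, 0, 1, 0) = 0 := by
    rw [h.2 x 0 1 0 (by simp [slopeDomain, hx]) one_ne_zero]; simp
  have hc : ContinuousAt (fun y => f x + F (x, y - x, 1, 0)) x := by
    refine continuousAt_const.add (ContinuousAt.comp (g := F) (by simpa using hF) ?_)
    fun_prop
  refine hc.congr ?_
  filter_upwards [hU.mem_nhds hx] with y hy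
  rw [h.2 x (y - x) 1 0 ⟨by simpa using hy, by simpa using hx⟩ one_ne_zero]
  simp

/-- Uniqueness of the extended slope: points with `t ≠ s` are dense in `U^[1]`. -/
theorem IsSlopeExtension.eqOn [T2Space W] {U : Set V} (hU : IsOpen U) {f : V → W}
    {F G : V × V × 𝕜 × 𝕜 → W} (hF : IsSlopeExtension 𝕜 U f F) (hG : IsSlopeExtension 𝕜 U f G) :
    EqOn F G (slopeDomain 𝕜 U) := by
  rintro ⟨x, v, t, s⟩ hp
  by_cases hts : t = s
  · subst hts
    have hmem := (isOpen_slopeDomain hU).mem_nhds hp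
    have hlim : Tendsto (fun r : 𝕜 => (x, v, r, t)) (𝓝[≠] t) (𝓝 (x, v, t, t)) :=
      (ContinuousAt.tendsto (x := t) (f := fun r : 𝕜 => (x, v, r, t)) (by fun_prop)).mono_left
        nhdsWithin_le_nhds
    refine tendsto_nhds_unique ((hF.1.continuousAt hmem).tendsto.comp hlim)
      (((hG.1.continuousAt hmem).tendsto.comp hlim).congr' ?_)
    filter_upwards [self_mem_nhdsWithin, hlim hmem] with r hr hr'
    simp only [Function.comp_apply]
    rw [hF.2 x v r t hr' hr, hG.2 x v r t hr' hr]
  · rw [hF.2 x v t s hp hts, hG.2 x v t s hp hts]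

end Slope

section SlopeMap

variable {V : Type u} [AddCommGroup V] [Module 𝕜 V] [TopologicalSpace V]
  {W : Type v} [AddCommGroup W] [Module 𝕜 W] [TopologicalSpace W]

theorem IsC1.isSlopeExtension {U : Set V} {f : V → W} (h : IsC1 𝕜 U f) :
    IsSlopeExtension 𝕜 U f (slopeMap 𝕜 U f) := by
  rw [slopeMap, dif_pos h]
  exact h.choose_spec

/-- The slope maps agree everywhere, not only on `U^[1]`: both are chosen from the same set of
extensions, which does not depend on values outside `U`. -/
theorem slopeMap_congr {U : Set V} {f g : V → W} (h : EqOn f g U) :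
    slopeMap 𝕜 U f = slopeMap 𝕜 U g := by
  have : IsSlopeExtension 𝕜 U f = IsSlopeExtension 𝕜 U g := by
    ext F
    refine and_congr_right fun _ => forall₄_congr fun v₀ v₁ t s => forall₂_congr fun hp _ => ?_
    rw [h hp.1, h hp.2]
  classical
  exact congrArg (fun P : (V × V × 𝕜 × 𝕜 → W) → Prop => if h : ∃ F, P F then h.choose else 0) this

end SlopeMap

/-! ### Maps of class `Cⁿ` in the sense of Bastiani -/

variable (𝕜) in
/-- The map `f : U → W` is of class `Cⁿ` in the sense of Bastiani: it is continuous and, if `n ≥ 1`,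
has directional derivatives `δ (x, v)` at all `x ∈ U` such that `δ : U × V → W` is of class `Cⁿ⁻¹`.
The derivative `δ` is asserted to exist rather than chosen canonically, so that the notion makes
sense for targets that are not Hausdorff, such as the space containing `U`. -/
def IsCBastiani : (n : ℕ) → {V : Type u} → {W : Type v} →
    [AddCommGroup V] → [Module 𝕜 V] → [TopologicalSpace V] →
    [AddCommGroup W] → [Module 𝕜 W] → [TopologicalSpace W] → Set V → (V → W) → Prop
  | 0, _, _, _, _, _, _, _, _, U, f => ContinuousOn f U
  | n + 1, V, W, _, _, _, _, _, _, U, f => ContinuousOn f U ∧ ∃ δ : V × V → W,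
      (∀ x ∈ U, ∀ v, HasDirDeriv 𝕜 f (δ (x, v)) x v) ∧ IsCBastiani n (U ×ˢ univ) δ

section Basic

variable {V : Type u} [AddCommGroup V] [Module 𝕜 V] [TopologicalSpace V]
  {W : Type v} [AddCommGroup W] [Module 𝕜 W] [TopologicalSpace W]

theorem IsCBastiani.continuousOn {n : ℕ} {U : Set V} {f : V → W} (h : IsCBastiani 𝕜 n U f) :
    ContinuousOn f U := by
  cases n with
  | zero => exact h
  | succ n => exact h.1

theorem IsCBastiani.of_succ {n : ℕ} : ∀ {V : Type u} [AddCommGroup V] [Module 𝕜 V]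
    [TopologicalSpace V] {U : Set V} {f : V → W}, IsCBastiani 𝕜 (n + 1) U f →
    IsCBastiani 𝕜 n U f := by
  induction n with
  | zero => intro V _ _ _ U f h; exact h.1
  | succ n ih =>
    rintro V _ _ _ U f ⟨hf, δ, hd, hδ⟩
    exact ⟨hf, δ, hd, ih hδ⟩

theorem IsCBastiani.mono {n : ℕ} : ∀ {V : Type u} [AddCommGroup V] [Module 𝕜 V]
    [TopologicalSpace V] {U U' : Set V} {f : V → W}, IsCBastiani 𝕜 n U f → U' ⊆ U →
    IsCBastiani 𝕜 n U' f := by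
  induction n with
  | zero => intro V _ _ _ U U' f h hU; exact ContinuousOn.mono h hU
  | succ n ih =>
    rintro V _ _ _ U U' f ⟨hf, δ, hd, hδ⟩ hU
    exact ⟨hf.mono hU, δ, fun x hx => hd x (hU hx), ih hδ (prod_mono hU subset_rfl)⟩

theorem IsCBastiani.congr {n : ℕ} : ∀ {V : Type u} [AddCommGroup V] [Module 𝕜 V]
    [TopologicalSpace V] [IsTopologicalAddGroup V] [ContinuousSMul 𝕜 V] {U : Set V} {f g : V → W},
    IsOpen U → IsCBastiani 𝕜 n U f → EqOn f g U → IsCBastiani 𝕜 n U g := by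
  cases n with
  | zero => intro V _ _ _ _ _ U f g _ h hfg; exact ContinuousOn.congr h hfg.symm
  | succ n =>
    rintro V _ _ _ _ _ U f g hU ⟨hf, δ, hd, hδ⟩ hfg
    exact ⟨hf.congr hfg.symm, δ, fun x hx v => (hd x hx v).congr_of_eqOn hU hfg hx, hδ⟩

/-- The Bastiani classes are local; the local derivatives agree where they are both defined, because
limits in `W` are unique. -/
theorem IsCBastiani.of_local [T2Space W] {n : ℕ} : ∀ {V : Type u} [AddCommGroup V] [Module 𝕜 V]
    [TopologicalSpace V] [IsTopologicalAddGroup V] [ContinuousSMul 𝕜 V] {U : Set V} {f : V → W},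
    IsOpen U → (∀ x ∈ U, ∃ O, IsOpen O ∧ x ∈ O ∧ IsCBastiani 𝕜 n O f) → IsCBastiani 𝕜 n U f := by
  induction n with
  | zero =>
    intro V _ _ _ _ _ U f _ h x hx
    obtain ⟨O, hO, hxO, hf⟩ := h x hx
    exact (ContinuousOn.continuousAt hf (hO.mem_nhds hxO)).continuousWithinAt
  | succ n ih =>
    intro V _ _ _ _ _ U f hU h
    choose! O hO hxO hf using h
    choose hc δ hd hδ using hf
    have hex : ∀ p : V × V, ∃ w, p.1 ∈ U → HasDirDeriv 𝕜 f w p.1 p.2 := fun p => by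
      by_cases hp : p.1 ∈ U
      · exact ⟨δ p.1 hp p, fun _ => hd p.1 hp p.1 (hxO _ hp) p.2⟩
      · exact ⟨0, fun h => absurd h hp⟩
    choose D hD using hex
    refine ⟨fun x hx => ((hc x hx).continuousAt ((hO x hx).mem_nhds (hxO x hx))).continuousWithinAt,
      fun p => D p, fun x hx v => hD (x, v) hx, ih (hU.prod isOpen_univ) fun p hp => ?_⟩
    have hO' : IsOpen ((O p.1 ∩ U) ×ˢ (univ : Set V)) :=
      ((hO p.1 hp.1).inter hU).prod isOpen_univ
    refine ⟨_, hO', ⟨⟨hxO p.1 hp.1, hp.1⟩, mem_univ _⟩,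
      ((hδ p.1 hp.1).mono (prod_mono inter_subset_left subset_rfl)).congr hO' fun q hq => ?_⟩
    exact (hd p.1 hp.1 q.1 hq.1.1 q.2).unique (hD q hq.1.2)

end Basic

/-! ### Calculus in the Bastiani classes -/

section Calculus

variable {W : Type v} [AddCommGroup W] [Module 𝕜 W] [TopologicalSpace W]

theorem IsCBastiani.const (n : ℕ) : ∀ {V : Type u} [AddCommGroup V] [Module 𝕜 V]
    [TopologicalSpace V] (U : Set V) (c : W), IsCBastiani 𝕜 n U fun _ => c := by
  induction n with
  | zero => intro V _ _ _ U c; exact continuousOn_const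
  | succ n ih =>
    intro V _ _ _ U c
    exact ⟨continuousOn_const, fun _ => 0, fun x _ v => HasDirDeriv.const c x v, ih _ _⟩

theorem IsCBastiani.prodMk {W' : Type w} [AddCommGroup W'] [Module 𝕜 W'] [TopologicalSpace W']
    {n : ℕ} : ∀ {V : Type u} [AddCommGroup V] [Module 𝕜 V]
    [TopologicalSpace V] {U : Set V} {f : V → W} {g : V → W'}, IsCBastiani 𝕜 n U f →
    IsCBastiani 𝕜 n U g → IsCBastiani 𝕜 n U fun x => (f x, g x) := by
  induction n with
  | zero => intro V _ _ _ U f g hf hg; exact ContinuousOn.prodMk hf hg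
  | succ n ih =>
    rintro V _ _ _ U f g ⟨hf, δ, hd, hδ⟩ ⟨hg, δ', hd', hδ'⟩
    exact ⟨hf.prodMk hg, fun p => (δ p, δ' p), fun x hx v => (hd x hx v).prodMk (hd' x hx v),
      ih hδ hδ'⟩

theorem IsCBastiani.comp_clm {n : ℕ} : ∀ {E : Type w} [AddCommGroup E] [Module 𝕜 E]
    [TopologicalSpace E] {V : Type u} [AddCommGroup V] [Module 𝕜 V]
    [TopologicalSpace V] {U : Set V} {f : V → W}, IsCBastiani 𝕜 n U f → ∀ (L : E →L[𝕜] V)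
    {Ω : Set E}, MapsTo L Ω U → IsCBastiani 𝕜 n Ω fun x => f (L x) := by
  induction n with
  | zero =>
    intro E _ _ _ V _ _ _ U f hf L Ω hL
    exact ContinuousOn.comp hf L.continuous.continuousOn hL
  | succ n ih =>
    rintro E _ _ _ V _ _ _ U f ⟨hf, δ, hd, hδ⟩ L Ω hL
    refine ⟨hf.comp L.continuous.continuousOn hL, fun p => δ (L p.1, L p.2), fun x hx v => ?_,
      ih hδ (L.prodMap L) fun p hp => ⟨hL hp.1, mem_univ _⟩⟩
    have := hd (L x) (hL hx) (L v)
    simpa [HasDirDeriv] using this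

theorem IsCBastiani.clm_comp {W' : Type w} [AddCommGroup W'] [Module 𝕜 W'] [TopologicalSpace W']
    (L : W →L[𝕜] W') {n : ℕ} : ∀ {V : Type u} [AddCommGroup V] [Module 𝕜 V]
    [TopologicalSpace V] {U : Set V} {f : V → W}, IsCBastiani 𝕜 n U f →
    IsCBastiani 𝕜 n U fun x => L (f x) := by
  induction n with
  | zero => intro V _ _ _ U f hf; exact L.continuous.comp_continuousOn hf
  | succ n ih =>
    rintro V _ _ _ U f ⟨hf, δ, hd, hδ⟩
    refine ⟨L.continuous.comp_continuousOn hf, fun p => L (δ p), fun x hx v => ?_, ih hδ⟩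
    refine ((L.continuous.tendsto _).comp (hd x hx v)).congr fun t => ?_
    simp

theorem IsCBastiani.clm {n : ℕ} : ∀ {V : Type u} [AddCommGroup V] [Module 𝕜 V]
    [TopologicalSpace V] (L : V →L[𝕜] W) (U : Set V), IsCBastiani 𝕜 n U L := by
  induction n with
  | zero => intro V _ _ _ L U; exact L.continuous.continuousOn
  | succ n ih =>
    intro V _ _ _ L U
    refine ⟨L.continuous.continuousOn, L.comp (ContinuousLinearMap.snd 𝕜 V V), fun x _ v => ?_,
      ih _ _⟩
    refine tendsto_const_nhds.congr' ?_
    filter_upwards [self_mem_nhdsWithin] with t ht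
    simp [inv_smul_smul₀ (show t ≠ 0 from ht)]

theorem IsCBastiani.add [IsTopologicalAddGroup W] {n : ℕ} {V : Type u} [AddCommGroup V]
    [Module 𝕜 V] [TopologicalSpace V] {U : Set V} {f g : V → W} (hf : IsCBastiani 𝕜 n U f)
    (hg : IsCBastiani 𝕜 n U g) : IsCBastiani 𝕜 n U fun x => f x + g x :=
  (hf.prodMk hg).clm_comp (ContinuousLinearMap.fst 𝕜 W W + ContinuousLinearMap.snd 𝕜 W W)

theorem IsCBastiani.sub [IsTopologicalAddGroup W] {n : ℕ} {V : Type u} [AddCommGroup V]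
    [Module 𝕜 V] [TopologicalSpace V] {U : Set V} {f g : V → W} (hf : IsCBastiani 𝕜 n U f)
    (hg : IsCBastiani 𝕜 n U g) : IsCBastiani 𝕜 n U fun x => f x - g x :=
  (hf.prodMk hg).clm_comp (ContinuousLinearMap.fst 𝕜 W W - ContinuousLinearMap.snd 𝕜 W W)

theorem IsCBastiani.sum [IsTopologicalAddGroup W] {n : ℕ} {V : Type u} [AddCommGroup V]
    [Module 𝕜 V] [TopologicalSpace V] {U : Set V} {ι : Type*} (s : Finset ι) {f : ι → V → W}
    (hf : ∀ i, IsCBastiani 𝕜 n U (f i)) : IsCBastiani 𝕜 n U fun x => ∑ i ∈ s, f i x := by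
  classical
  induction s using Finset.induction_on with
  | empty => simpa using IsCBastiani.const n U (0 : W)
  | insert i s hi ih => simpa [Finset.sum_insert hi] using (hf i).add ih

variable [IsTopologicalAddGroup W] [ContinuousSMul 𝕜 W]

theorem isCBastiani_smul (n : ℕ) :
    IsCBastiani 𝕜 n univ (fun p : 𝕜 × W => p.1 • p.2) := by
  induction n with
  | zero => exact continuous_smul.continuousOn
  | succ n ih =>
    have h1 := ih.comp_clm (E := (𝕜 × W) × (𝕜 × W)) (Ω := univ ×ˢ univ)
      (((ContinuousLinearMap.fst 𝕜 𝕜 W).comp (ContinuousLinearMap.fst 𝕜 _ _)).prod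
        ((ContinuousLinearMap.snd 𝕜 𝕜 W).comp (ContinuousLinearMap.snd 𝕜 _ _)))
      (fun _ _ => mem_univ _)
    have h2 := ih.comp_clm (E := (𝕜 × W) × (𝕜 × W)) (Ω := univ ×ˢ univ)
      (((ContinuousLinearMap.fst 𝕜 𝕜 W).comp (ContinuousLinearMap.snd 𝕜 _ _)).prod
        ((ContinuousLinearMap.snd 𝕜 𝕜 W).comp (ContinuousLinearMap.fst 𝕜 _ _)))
      (fun _ _ => mem_univ _)
    refine ⟨continuous_smul.continuousOn, _, fun p _ v => ?_, h1.add h2⟩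
    have hc : ContinuousAt (fun t : 𝕜 => p.1 • v.2 + v.1 • p.2 + t • v.1 • v.2) 0 := by fun_prop
    have := hc.tendsto.mono_left (nhdsWithin_le_nhds (s := {0}ᶜ))
    rw [zero_smul, add_zero] at this
    refine this.congr' ?_
    filter_upwards [self_mem_nhdsWithin] with t ht
    have ht : t ≠ 0 := ht
    rw [eq_inv_smul_iff₀ ht]
    simp only [Prod.fst_add, Prod.snd_add, Prod.smul_fst, Prod.smul_snd, smul_eq_mul]
    module

/-- The first-order chain rule. The outer map has a jointly continuous derivative; for the inner one
a directional derivative at one point is enough. -/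
theorem HasDirDeriv.comp {V : Type u} [AddCommGroup V] [Module 𝕜 V] [TopologicalSpace V]
    [IsTopologicalAddGroup V] [ContinuousSMul 𝕜 V]
    [Module ℝ W] [IsScalarTower ℝ 𝕜 W] [ContinuousSMul ℝ W] [LocallyConvexSpace ℝ W]
    {U : Set V} (hU : IsOpen U) {f : V → W} {δ : V × V → W} (hf : ContinuousOn f U)
    (hd : ∀ x ∈ U, ∀ v, HasDirDeriv 𝕜 f (δ (x, v)) x v) (hδ : ContinuousOn δ (U ×ˢ univ))
    {E : Type w} [AddCommGroup E] [Module 𝕜 E] {h : E → V} {x v : E} {y : V} (hx : h x ∈ U)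
    (hh : HasDirDeriv 𝕜 h y x v) : HasDirDeriv 𝕜 (fun z => f (h z)) (δ (h x, y)) x v := by
  have hF := isSlopeExtension_completedSlope hU hf hd hδ
  have hmem := (isOpen_slopeDomain (𝕜 := 𝕜) hU).mem_nhds
    (show (h x, y, 0, 0) ∈ slopeDomain 𝕜 U by simp [slopeDomain, hx])
  have hlim : Tendsto (fun t : 𝕜 => (h x, t⁻¹ • (h (x + t • v) - h x), t, (0 : 𝕜))) (𝓝[≠] 0)
      (𝓝 (h x, y, 0, 0)) :=
    tendsto_const_nhds.prodMk_nhds (hh.prodMk_nhds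
      ((tendsto_id.mono_left nhdsWithin_le_nhds).prodMk_nhds tendsto_const_nhds))
  have hval : completedSlope f δ (h x, y, (0 : 𝕜), (0 : 𝕜)) = δ (h x, y) := by simp [completedSlope]
  rw [HasDirDeriv, ← hval]
  refine ((hF.1.continuousAt hmem).tendsto.comp hlim).congr' ?_
  filter_upwards [self_mem_nhdsWithin, hlim hmem] with t ht htU
  have ht : t ≠ 0 := ht
  simp only [Function.comp_apply]
  rw [hF.2 _ _ _ _ htU ht, smul_inv_smul₀ ht]
  simp

variable [Module ℝ W] [IsScalarTower ℝ 𝕜 W] [ContinuousSMul ℝ W] [LocallyConvexSpace ℝ W]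

theorem IsCBastiani.comp {n : ℕ} : ∀ {V : Type u} [AddCommGroup V] [Module 𝕜 V]
    [TopologicalSpace V] [IsTopologicalAddGroup V] [ContinuousSMul 𝕜 V]
    {E : Type w} [AddCommGroup E] [Module 𝕜 E] [TopologicalSpace E]
    {U : Set V} {f : V → W} {Ω : Set E} {h : E → V}, IsOpen U →
    IsCBastiani 𝕜 n U f → IsCBastiani 𝕜 n Ω h → MapsTo h Ω U →
    IsCBastiani 𝕜 n Ω fun x => f (h x) := by
  induction n with
  | zero =>
    intro V _ _ _ _ _ E _ _ _ U f Ω h _ hf hh hm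
    exact ContinuousOn.comp hf hh hm
  | succ n ih =>
    rintro V _ _ _ _ _ E _ _ _ U f Ω h hU ⟨hf, δ, hd, hδ⟩ hh hm
    have hh' := hh.of_succ
    obtain ⟨hhc, γ, hγd, hγ⟩ := hh
    refine ⟨hf.comp hhc hm, fun p => δ (h p.1, γ p),
      fun x hx v => HasDirDeriv.comp hU hf hd hδ.continuousOn (hm hx) (hγd x hx v),
      ih (hU.prod isOpen_univ) hδ (IsCBastiani.prodMk ?_ hγ) fun p hp => ⟨hm hp.1, mem_univ _⟩⟩
    exact hh'.comp_clm (ContinuousLinearMap.fst 𝕜 E E) fun p hp => hp.1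

theorem IsCBastiani.smul {n : ℕ} {E : Type u} [AddCommGroup E] [Module 𝕜 E] [TopologicalSpace E]
    {Ω : Set E} {c : E → 𝕜} {f : E → W} (hc : IsCBastiani 𝕜 n Ω c) (hf : IsCBastiani 𝕜 n Ω f) :
    IsCBastiani 𝕜 n Ω fun x => c x • f x :=
  (isCBastiani_smul n).comp isOpen_univ (hc.prodMk hf) fun _ _ => mem_univ _

theorem isCBastiani_inv (n : ℕ) : IsCBastiani 𝕜 n {0}ᶜ (fun c : 𝕜 => c⁻¹) := by
  induction n with
  | zero => exact continuousOn_inv₀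
  | succ n ih =>
    have hinv := ih.comp_clm (ContinuousLinearMap.fst 𝕜 𝕜 𝕜) (Ω := {0}ᶜ ×ˢ univ)
      fun p hp => hp.1
    have hmul := (hinv.smul (hinv.smul (IsCBastiani.clm (-ContinuousLinearMap.snd 𝕜 𝕜 𝕜) _)))
    refine ⟨continuousOn_inv₀, _, fun c hc v => ?_, hmul⟩
    have hc : c ≠ 0 := hc
    have hcont : ContinuousAt (fun t : 𝕜 => -(c⁻¹ * ((c + t * v)⁻¹ * v))) 0 := by
      refine ContinuousAt.neg (ContinuousAt.mul continuousAt_const (ContinuousAt.mul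
        (ContinuousAt.inv₀ (by fun_prop) (by simpa using hc)) continuousAt_const))
    have hlim := hcont.tendsto.mono_left (nhdsWithin_le_nhds (s := {0}ᶜ))
    have hval : -(c⁻¹ * ((c + 0 * v)⁻¹ * v)) =
        (ContinuousLinearMap.fst 𝕜 𝕜 𝕜 (c, v))⁻¹ • (ContinuousLinearMap.fst 𝕜 𝕜 𝕜 (c, v))⁻¹ •
          (-ContinuousLinearMap.snd 𝕜 𝕜 𝕜) (c, v) := by simp
    rw [hval] at hlim
    refine hlim.congr' ?_
    filter_upwards [self_mem_nhdsWithin, (eventually_add_smul_mem isOpen_compl_singleton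
      (show c ∈ ({0}ᶜ : Set 𝕜) from hc) v).filter_mono nhdsWithin_le_nhds] with t ht htc
    have ht : t ≠ 0 := ht
    have htc : c + t * v ≠ 0 := htc
    simp only [smul_eq_mul]
    field_simp
    ring

theorem IsCBastiani.inv {n : ℕ} {E : Type u} [AddCommGroup E] [Module 𝕜 E] [TopologicalSpace E]
    {Ω : Set E} {c : E → 𝕜} (hc : IsCBastiani 𝕜 n Ω c) (h0 : ∀ x ∈ Ω, c x ≠ 0) :
    IsCBastiani 𝕜 n Ω fun x => (c x)⁻¹ :=
  (isCBastiani_inv n).comp isOpen_compl_singleton hc h0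

end Calculus

/-! ### Weak averages -/

section Integral

variable {W : Type v} [AddCommGroup W] [Module 𝕜 W] [TopologicalSpace W]
  [Module ℝ W] [IsScalarTower ℝ 𝕜 W]

/-- Differentiation under the integral sign, for integrals tested against a real functional. -/
theorem hasDerivAt_integral_dual {V : Type u} [AddCommGroup V] [Module 𝕜 V] [TopologicalSpace V]
    [IsTopologicalAddGroup V] [ContinuousSMul 𝕜 V] {U : Set V} (hU : IsOpen U) {f : V → W}
    {δ : V × V → W} (hf : ContinuousOn f U)
    (hd : ∀ x ∈ U, ∀ v, HasDirDeriv 𝕜 f (δ (x, v)) x v) (hδ : ContinuousOn δ (U ×ˢ univ))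
    {x v : ℝ → V} (hx : Continuous x) (hv : Continuous v) (hxU : ∀ u ∈ Icc (0 : ℝ) 1, x u ∈ U)
    {c : ℝ → ℝ} (hc : Continuous c) (ℓ : W →L[ℝ] ℝ) :
    HasDerivAt (fun e : ℝ => ∫ u in (0 : ℝ)..1, c u * ℓ (f (x u + (e : 𝕜) • v u)))
      (∫ u in (0 : ℝ)..1, c u * ℓ (δ (x u, v u))) 0 := by
  have hγ : Continuous fun p : ℝ × ℝ => x p.2 + (p.1 : 𝕜) • v p.2 := by
    have : Continuous fun p : ℝ × ℝ => (p.1 : 𝕜) := RCLike.continuous_ofReal.comp continuous_fst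
    fun_prop
  obtain ⟨A, B, hA, -, h0A, hB, hAB⟩ := generalized_tube_lemma (isCompact_singleton (x := (0 : ℝ)))
    (isCompact_Icc (a := (0 : ℝ)) (b := 1)) (hU.preimage hγ) (by
      rintro ⟨e, u⟩ ⟨he, hu⟩
      obtain rfl : e = 0 := he
      simpa using hxU u hu)
  obtain ⟨η, hη, hηA⟩ := Metric.nhds_basis_closedBall.mem_iff.1
    (hA.mem_nhds (h0A (mem_singleton (0 : ℝ))))
  have hmem : ∀ e ∈ Metric.closedBall (0 : ℝ) η, ∀ u ∈ Icc (0 : ℝ) 1, x u + (e : 𝕜) • v u ∈ U :=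
    fun e he u hu => hAB (mk_mem_prod (hηA he) (hB hu))
  have hcF : ∀ e ∈ Metric.closedBall (0 : ℝ) η,
      ContinuousOn (fun u => c u * ℓ (f (x u + (e : 𝕜) • v u))) (Icc 0 1) := fun e he =>
    hc.continuousOn.mul (ℓ.continuous.comp_continuousOn
      (hf.comp (by fun_prop) fun u hu => hmem e he u hu))
  have hcF' : ContinuousOn (fun p : ℝ × ℝ => c p.2 * ℓ (δ (x p.2 + (p.1 : 𝕜) • v p.2, v p.2)))
      (Metric.closedBall (0 : ℝ) η ×ˢ Icc 0 1) :=
    (hc.comp continuous_snd).continuousOn.mul (ℓ.continuous.comp_continuousOn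
      (hδ.comp (hγ.prodMk (hv.comp continuous_snd)).continuousOn
        fun p hp => ⟨hmem p.1 hp.1 p.2 hp.2, mem_univ _⟩))
  obtain ⟨K, hK⟩ :=
    ((isCompact_closedBall (0 : ℝ) η).prod isCompact_Icc).exists_bound_of_continuousOn hcF'
  have h0 : (0 : ℝ) ∈ Metric.closedBall (0 : ℝ) η := Metric.mem_closedBall_self hη.le
  have hI : uIoc (0 : ℝ) 1 ⊆ Icc 0 1 := by
    rw [uIoc_of_le zero_le_one]; exact Ioc_subset_Icc_self
  have hcF0 : ContinuousOn (fun u => c u * ℓ (δ (x u + ((0 : ℝ) : 𝕜) • v u, v u))) (Icc 0 1) :=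
    hcF'.comp (f := fun u : ℝ => ((0 : ℝ), u)) (by fun_prop) fun u hu => ⟨h0, hu⟩
  have key := (intervalIntegral.hasDerivAt_integral_of_dominated_loc_of_deriv_le
    (μ := MeasureTheory.volume) (a := 0) (b := 1)
    (F := fun (e : ℝ) (u : ℝ) => c u * ℓ (f (x u + (e : 𝕜) • v u)))
    (F' := fun (e : ℝ) (u : ℝ) => c u * ℓ (δ (x u + (e : 𝕜) • v u, v u)))
    (x₀ := 0) (bound := fun _ => K) (Metric.closedBall_mem_nhds 0 hη)
    (by
      filter_upwards [Metric.closedBall_mem_nhds 0 hη] with e he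
      exact ((hcF e he).mono hI).aestronglyMeasurable measurableSet_uIoc)
    (ContinuousOn.intervalIntegrable_of_Icc zero_le_one (hcF 0 h0))
    ((hcF0.mono hI).aestronglyMeasurable measurableSet_uIoc)
    (.of_forall fun u hu e he => hK (e, u) ⟨he, hI hu⟩)
    intervalIntegrable_const
    (.of_forall fun u hu e he =>
      ((hd _ (hmem e he u (hI hu)) (v u)).hasDerivAt_dual ℓ).const_mul (c u))).2
  simpa using key

end Integral

section Average

variable {W : Type v} [AddCommGroup W] [TopologicalSpace W] [Module ℝ W]

/-- `ψ` is the average of `φ` along radii in the last variable, with weight `uʲ`: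
`ψ (z, r) = ∫₀¹ uʲ φ (z, u r) du`. As `W` need not be complete, the integral is a weak one:
equality is demanded after composition with every real functional. -/
def IsRadialAverage {E : Type u} (j : ℕ) (N : Set E) (ε : ℝ) (φ ψ : E × 𝕜 → W) : Prop :=
  ∀ z ∈ N, ∀ r ∈ Metric.ball (0 : 𝕜) ε, ∀ ℓ : W →L[ℝ] ℝ,
    ℓ (ψ (z, r)) = ∫ u in (0 : ℝ)..1, u ^ j * ℓ (φ (z, (u : 𝕜) * r))

theorem ofReal_mul_mem_ball {u ε : ℝ} {r : 𝕜} (hr : r ∈ Metric.ball (0 : 𝕜) ε)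
    (hu : u ∈ Icc (0 : ℝ) 1) : (u : 𝕜) * r ∈ Metric.ball (0 : 𝕜) ε := by
  rw [mem_ball_zero_iff] at hr ⊢
  exact (norm_ofReal_mul_le hu r).trans_lt hr

theorem integral_pow_mul_const (j : ℕ) (c : ℝ) :
    ∫ u in (0 : ℝ)..1, u ^ j * c = ((j : ℝ) + 1)⁻¹ * c := by
  simp

theorem IsRadialAverage.apply_zero [IsTopologicalAddGroup W] [ContinuousSMul ℝ W]
    [LocallyConvexSpace ℝ W] [T2Space W] {E : Type u} {j : ℕ} {N : Set E} {ε : ℝ} {φ ψ : E × 𝕜 → W}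
    (h : IsRadialAverage j N ε φ ψ) (hε : 0 < ε) {z : E} (hz : z ∈ N) :
    ψ (z, 0) = ((j : ℝ) + 1)⁻¹ • φ (z, 0) := by
  refine eq_of_forall_dual_eq fun ℓ => ?_
  rw [h z hz 0 (Metric.mem_ball_self hε) ℓ]
  simp only [mul_zero]
  rw [integral_pow_mul_const, map_smul, smul_eq_mul]

variable {E : Type u} [TopologicalSpace E] {j : ℕ} {N : Set E} {ε : ℝ} {φ ψ : E × 𝕜 → W}

theorem continuousOn_radial (hφ : ContinuousOn φ (N ×ˢ Metric.ball 0 ε)) {z : E} (hz : z ∈ N)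
    {r : 𝕜} (hr : r ∈ Metric.ball (0 : 𝕜) ε) (ℓ : W →L[ℝ] ℝ) :
    ContinuousOn (fun u : ℝ => u ^ j * ℓ (φ (z, (u : 𝕜) * r))) (Icc 0 1) := by
  have h1 : Continuous fun u : ℝ => (u : 𝕜) := RCLike.continuous_ofReal
  exact (continuous_pow j).continuousOn.mul (ℓ.continuous.comp_continuousOn
    (hφ.comp (by fun_prop) fun u hu => ⟨hz, ofReal_mul_mem_ball hr hu⟩))

variable [IsTopologicalAddGroup W] [ContinuousSMul ℝ W] [LocallyConvexSpace ℝ W]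

theorem IsRadialAverage.mem {C : Set W} (h : IsRadialAverage j N ε φ ψ)
    (hφ : ContinuousOn φ (N ×ˢ Metric.ball 0 ε)) {z : E} (hz : z ∈ N)
    {r : 𝕜} (hr : r ∈ Metric.ball (0 : 𝕜) ε) (hC : IsClosed C) (hC' : Convex ℝ C)
    (hφC : ∀ u ∈ Icc (0 : ℝ) 1, φ (z, (u : 𝕜) * r) ∈ C) : ((j : ℝ) + 1) • ψ (z, r) ∈ C := by
  refine mem_of_forall_dual_le hC hC' fun ℓ c hc => ?_
  have hj : (0 : ℝ) < (j : ℝ) + 1 := by positivity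
  rw [map_smul, smul_eq_mul, h z hz r hr ℓ, ← le_inv_mul_iff₀ hj, ← integral_pow_mul_const]
  refine intervalIntegral.integral_mono_on zero_le_one
    (ContinuousOn.intervalIntegrable_of_Icc zero_le_one (continuousOn_radial hφ hz hr ℓ))
    (Continuous.intervalIntegrable (by fun_prop) _ _) fun u hu => ?_
  exact mul_le_mul_of_nonneg_left (hc _ (hφC u hu)) (pow_nonneg hu.1 j)

/-- Averaging preserves continuity at `r = 0`: a closed convex set containing the values of `φ`
contains those of `(j + 1) ψ`. -/
theorem IsRadialAverage.continuousOn [T2Space W] (h : IsRadialAverage j N ε φ ψ) (hN : IsOpen N)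
    (hφ : ContinuousOn φ (N ×ˢ Metric.ball 0 ε))
    (hψ : ContinuousOn ψ (N ×ˢ (Metric.ball 0 ε \ {0}))) :
    ContinuousOn ψ (N ×ˢ Metric.ball 0 ε) := by
  rintro ⟨z, r⟩ ⟨hz, hr⟩
  simp only at hz hr
  refine ContinuousAt.continuousWithinAt ?_
  rcases eq_or_ne r 0 with rfl | hr0
  swap
  · exact hψ.continuousAt ((hN.prod (Metric.isOpen_ball.sdiff isClosed_singleton)).mem_nhds
      ⟨hz, hr, hr0⟩)
  have hε : 0 < ε := Metric.pos_of_mem_ball hr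
  have hj : ((j : ℝ) + 1) ≠ 0 := by positivity
  intro O hO
  rw [h.apply_zero hε hz] at hO
  obtain ⟨C, hCφ, hC, hC', hCO⟩ := exists_isClosed_convex_mem_nhds_subset
    ((continuous_const_smul ((j : ℝ) + 1)⁻¹).continuousAt.preimage_mem_nhds hO)
  have hφ0 := (hφ.continuousAt ((hN.prod Metric.isOpen_ball).mem_nhds ⟨hz, hr⟩)).preimage_mem_nhds
    hCφ
  rw [nhds_prod_eq] at hφ0
  obtain ⟨A, hA, B, hB, hAB⟩ := mem_prod_iff.1 hφ0
  obtain ⟨η, hη, hball⟩ := Metric.mem_nhds_iff.1 hB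
  rw [Filter.mem_map]
  filter_upwards [prod_mem_nhds (inter_mem hA (hN.mem_nhds hz))
    (inter_mem (Metric.ball_mem_nhds (0 : 𝕜) hη) (Metric.ball_mem_nhds (0 : 𝕜) hε))]
  rintro ⟨z', r'⟩ ⟨⟨hz'A, hz'N⟩, hr'η, hr'ε⟩
  have := hCO (h.mem hφ hz'N hr'ε hC hC' fun u hu =>
    hAB (mk_mem_prod hz'A (hball (ofReal_mul_mem_ball hr'η hu))))
  simpa [smul_smul, inv_mul_cancel₀ hj] using this

end Average

/-! ### Differentiability of weak averages -/

section AverageClass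

theorem IsRadialAverage.hasDerivAt_dual {W : Type v} [AddCommGroup W] [Module 𝕜 W]
    [TopologicalSpace W] [Module ℝ W] [IsScalarTower ℝ 𝕜 W] {E : Type u} [AddCommGroup E]
    [Module 𝕜 E] [TopologicalSpace E] [IsTopologicalAddGroup E] [ContinuousSMul 𝕜 E] {j : ℕ}
    {N : Set E} {ε : ℝ}
    {φ ψ : E × 𝕜 → W} {δ : (E × 𝕜) × (E × 𝕜) → W} (h : IsRadialAverage j N ε φ ψ) (hN : IsOpen N)
    (hφ : ContinuousOn φ (N ×ˢ Metric.ball 0 ε))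
    (hd : ∀ x ∈ N ×ˢ Metric.ball 0 ε, ∀ v, HasDirDeriv 𝕜 φ (δ (x, v)) x v)
    (hδ : ContinuousOn δ ((N ×ˢ Metric.ball 0 ε) ×ˢ univ)) {z : E} (hz : z ∈ N) {r : 𝕜}
    (hr : r ∈ Metric.ball (0 : 𝕜) ε) (v : E × 𝕜) (ℓ : W →L[ℝ] ℝ) :
    HasDerivAt (fun e : ℝ => ℓ (ψ ((z, r) + (e : 𝕜) • v)))
      (∫ u in (0 : ℝ)..1, u ^ j * ℓ (δ ((z, (u : 𝕜) * r), (v.1, (u : 𝕜) * v.2)))) 0 := by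
  have hofReal : Continuous fun u : ℝ => (u : 𝕜) := RCLike.continuous_ofReal
  have hD : IsOpen (N ×ˢ Metric.ball (0 : 𝕜) ε) := hN.prod Metric.isOpen_ball
  have key := hasDerivAt_integral_dual hD hφ hd hδ (x := fun u => (z, (u : 𝕜) * r))
    (v := fun u => (v.1, (u : 𝕜) * v.2)) (by fun_prop) (by fun_prop)
    (fun u hu => ⟨hz, ofReal_mul_mem_ball hr hu⟩) (continuous_pow j) ℓ
  refine key.congr_of_eventuallyEq ?_
  have hlim : Tendsto (fun e : ℝ => (e : 𝕜)) (𝓝 0) (𝓝 0) := by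
    simpa using hofReal.tendsto 0
  filter_upwards [hlim (eventually_add_smul_mem hD (show (z, r) ∈ _ from ⟨hz, hr⟩) v)] with e he
  have he' : (z + (e : 𝕜) • v.1, r + (e : 𝕜) * v.2) ∈ N ×ˢ Metric.ball (0 : 𝕜) ε := he
  rw [show (z, r) + (e : 𝕜) • v = (z + (e : 𝕜) • v.1, r + (e : 𝕜) * v.2) from rfl,
    h _ he'.1 _ he'.2 ℓ]
  refine intervalIntegral.integral_congr fun u _ => ?_
  simp only [Prod.smul_mk, Prod.mk_add_mk, smul_eq_mul]
  congr 4
  ring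

variable {W : Type v} [AddCommGroup W] [Module 𝕜 W] [TopologicalSpace W] [IsTopologicalAddGroup W]
  [ContinuousSMul 𝕜 W] [Module ℝ W] [IsScalarTower ℝ 𝕜 W] [ContinuousSMul ℝ W]
  [LocallyConvexSpace ℝ W] [T2Space W]

theorem map_add_of_hasDirDeriv {V : Type u} [AddCommGroup V] [Module 𝕜 V] [TopologicalSpace V]
    [IsTopologicalAddGroup V] [ContinuousSMul 𝕜 V] {U : Set V} (hU : IsOpen U) {f : V → W}
    {δ : V × V → W} (hd : ∀ x ∈ U, ∀ v, HasDirDeriv 𝕜 f (δ (x, v)) x v)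
    (hδ : ContinuousOn δ (U ×ˢ univ)) {x : V} (hx : x ∈ U) (v v' : V) :
    δ (x, v + v') = δ (x, v) + δ (x, v') := by
  refine (hd x hx (v + v')).unique (HasDirDeriv.add_dir (δ := fun y => δ (y, v)) ?_ ?_ (hd x hx v'))
  · filter_upwards [hU.mem_nhds hx] with y hy using hd y hy v
  · exact ContinuousAt.comp (g := δ)
      (hδ.continuousAt ((hU.prod isOpen_univ).mem_nhds ⟨hx, mem_univ _⟩)) (by fun_prop)

/-- A radial average of class `Cᵐ` away from `r = 0` is of class `Cᵐ` altogether. Its derivative in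
the direction `(z', ρ)` is the sum of the average, with weight `uʲ`, of the derivative of `φ` in the
direction `(z', 0)`, and of `ρ` times the average, with weight `uʲ⁺¹`, of the derivative of `φ` in
the direction `(0, 1)`. For `r ≠ 0` these averages exist in `W` since `ψ` is differentiable there,
for `r = 0` since the functions to be averaged are multiples of powers of `u`. -/
theorem IsRadialAverage.isCBastiani {m : ℕ} : ∀ {E : Type u} [AddCommGroup E] [Module 𝕜 E]
    [TopologicalSpace E] [IsTopologicalAddGroup E] [ContinuousSMul 𝕜 E] {j : ℕ} {N : Set E} {ε : ℝ}
    {φ ψ : E × 𝕜 → W}, IsRadialAverage j N ε φ ψ → IsOpen N →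
    IsCBastiani 𝕜 m (N ×ˢ Metric.ball 0 ε) φ → IsCBastiani 𝕜 m (N ×ˢ (Metric.ball 0 ε \ {0})) ψ →
    IsCBastiani 𝕜 m (N ×ˢ Metric.ball 0 ε) ψ := by
  induction m with
  | zero =>
    intro E _ _ _ _ _ j N ε φ ψ h hN hφ hψ
    exact h.continuousOn hN hφ hψ
  | succ m ih =>
    rintro E _ _ _ _ _ j N ε φ ψ h hN ⟨hφ, δ, hd, hδ⟩ ⟨hψ, γ, hγd, hγ⟩
    have hD : IsOpen (N ×ˢ Metric.ball (0 : 𝕜) ε) := hN.prod Metric.isOpen_ball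
    have hB0 : IsOpen (Metric.ball (0 : 𝕜) ε \ {0}) := Metric.isOpen_ball.sdiff isClosed_singleton
    have hNu : IsOpen (N ×ˢ (univ : Set E)) := hN.prod isOpen_univ
    have hder := fun {z : E} (hz : z ∈ N) {r : 𝕜} (hr : r ∈ Metric.ball (0 : 𝕜) ε) v ℓ =>
      h.hasDerivAt_dual hN hφ hd hδ.continuousOn hz hr v ℓ
    -- away from `r = 0` the derivative of `ψ` is a weak average
    have hγℓ : ∀ {z : E}, z ∈ N → ∀ {r : 𝕜}, r ∈ Metric.ball (0 : 𝕜) ε → r ≠ 0 →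
        ∀ (v : E × 𝕜) (ℓ : W →L[ℝ] ℝ),
        ℓ (γ ((z, r), v)) =
          ∫ u in (0 : ℝ)..1, u ^ j * ℓ (δ ((z, (u : 𝕜) * r), (v.1, (u : 𝕜) * v.2))) := by
      intro z hz r hr hr0 v ℓ
      refine HasDerivAt.unique ?_ (hder hz hr v ℓ)
      refine HasDirDeriv.hasDerivAt_dual (𝕜 := 𝕜) ?_ ℓ
      simpa using hγd (z, r) ⟨hz, hr, hr0⟩ v
    have hδadd := fun {x} hx v v' => map_add_of_hasDirDeriv (x := x) hD hd hδ.continuousOn hx v v'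
    have hδsmul : ∀ x ∈ N ×ˢ Metric.ball (0 : 𝕜) ε, ∀ v (c : 𝕜), δ (x, c • v) = c • δ (x, v) :=
      fun x hx v c => (hd x hx (c • v)).unique ((hd x hx v).smul_dir c)
    classical
    let φ₁ : (E × E) × 𝕜 → W := fun p => δ ((p.1.1, p.2), (p.1.2, 0))
    let ψ₁ : (E × E) × 𝕜 → W := fun p =>
      if p.2 = 0 then ((j : ℝ) + 1)⁻¹ • φ₁ (p.1, 0) else γ ((p.1.1, p.2), (p.1.2, 0))
    let φ₂ : E × 𝕜 → W := fun p => δ (p, (0, 1))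
    let ψ₂ : E × 𝕜 → W := fun p =>
      if p.2 = 0 then (((j + 1 : ℕ) : ℝ) + 1)⁻¹ • φ₂ (p.1, 0) else γ (p, (0, 1))
    have h₁ : IsRadialAverage j (N ×ˢ univ) ε φ₁ ψ₁ := by
      rintro ⟨z, z'⟩ ⟨hz, -⟩ r hr ℓ
      by_cases hr0 : r = 0
      · simp only [ψ₁, hr0, if_true, mul_zero]
        rw [integral_pow_mul_const, map_smul, smul_eq_mul]
      · simp only [ψ₁, φ₁, hr0, if_false]
        rw [hγℓ hz hr hr0]
        simp only [mul_zero]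
    have h₂ : IsRadialAverage (j + 1) N ε φ₂ ψ₂ := by
      rintro z hz r hr ℓ
      by_cases hr0 : r = 0
      · simp only [ψ₂, hr0, if_true, mul_zero]
        rw [integral_pow_mul_const, map_smul, smul_eq_mul]
      · simp only [ψ₂, φ₂, hr0, if_false]
        rw [hγℓ hz hr hr0]
        refine intervalIntegral.integral_congr fun u hu => ?_
        rw [uIcc_of_le zero_le_one] at hu
        have := hδsmul (z, (u : 𝕜) * r) ⟨hz, ofReal_mul_mem_ball hr hu⟩ (0, 1) (u : 𝕜)
        rw [Prod.smul_mk, smul_zero, smul_eq_mul, ofReal_smul] at this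
        rw [this, map_smul, smul_eq_mul]
        ring
    have hψ₁ : IsCBastiani 𝕜 m ((N ×ˢ univ) ×ˢ Metric.ball 0 ε) ψ₁ := by
      refine ih h₁ hNu ?_ ?_
      · exact hδ.comp_clm (E := (E × E) × 𝕜)
          ((((ContinuousLinearMap.fst 𝕜 E E).comp (.fst 𝕜 _ 𝕜)).prod (.snd 𝕜 (E × E) 𝕜)).prod
            (((ContinuousLinearMap.snd 𝕜 E E).comp (.fst 𝕜 _ 𝕜)).prod 0))
          (fun p hp => ⟨⟨hp.1.1, hp.2⟩, mem_univ _⟩)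
      · refine (hγ.comp_clm (E := (E × E) × 𝕜) (Ω := (N ×ˢ univ) ×ˢ (Metric.ball 0 ε \ {0}))
          ((((ContinuousLinearMap.fst 𝕜 E E).comp (.fst 𝕜 _ 𝕜)).prod (.snd 𝕜 (E × E) 𝕜)).prod
            (((ContinuousLinearMap.snd 𝕜 E E).comp (.fst 𝕜 _ 𝕜)).prod 0))
          (fun p hp => ⟨⟨hp.1.1, hp.2⟩, mem_univ _⟩)).congr (hNu.prod hB0) fun p hp => ?_
        simp [ψ₁, show p.2 ≠ 0 from hp.2.2]
    have hψ₂ : IsCBastiani 𝕜 m (N ×ˢ Metric.ball 0 ε) ψ₂ := by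
      have hmap : IsCBastiani 𝕜 m univ fun p : E × 𝕜 => (p, ((0 : E), (1 : 𝕜))) :=
        (IsCBastiani.clm (ContinuousLinearMap.id 𝕜 (E × 𝕜)) univ).prodMk (.const m _ _)
      refine ih h₂ hN ?_ ?_
      · exact hδ.comp (hD.prod isOpen_univ) (hmap.mono (subset_univ _))
          fun p hp => ⟨hp, mem_univ _⟩
      · refine (hγ.comp ((hN.prod hB0).prod isOpen_univ) (hmap.mono (subset_univ _))
          fun p hp => ⟨hp, mem_univ _⟩).congr (hN.prod hB0) fun p hp => ?_
        simp [ψ₂, show p.2 ≠ 0 from hp.2.2]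
    have hΔ : IsCBastiani 𝕜 m ((N ×ˢ Metric.ball (0 : 𝕜) ε) ×ˢ univ)
        (fun p : (E × 𝕜) × (E × 𝕜) => ψ₁ ((p.1.1, p.2.1), p.1.2) + p.2.2 • ψ₂ p.1) := by
      refine IsCBastiani.add ?_ (IsCBastiani.smul ?_ ?_)
      · exact hψ₁.comp_clm (E := (E × 𝕜) × (E × 𝕜))
          ((((ContinuousLinearMap.fst 𝕜 E 𝕜).comp (.fst 𝕜 (E × 𝕜) (E × 𝕜))).prod
            ((ContinuousLinearMap.fst 𝕜 E 𝕜).comp (.snd 𝕜 (E × 𝕜) (E × 𝕜)))).prod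
            ((ContinuousLinearMap.snd 𝕜 E 𝕜).comp (.fst 𝕜 (E × 𝕜) (E × 𝕜))))
          fun p hp => ⟨⟨hp.1.1, mem_univ _⟩, hp.1.2⟩
      · exact IsCBastiani.clm ((ContinuousLinearMap.snd 𝕜 E 𝕜).comp (.snd 𝕜 (E × 𝕜) (E × 𝕜))) _
      · exact hψ₂.comp_clm (ContinuousLinearMap.fst 𝕜 (E × 𝕜) (E × 𝕜)) fun p hp => hp.1
    have hΔℓ : ∀ x ∈ N ×ˢ Metric.ball (0 : 𝕜) ε, ∀ (v : E × 𝕜) (ℓ : W →L[ℝ] ℝ),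
        ℓ (ψ₁ ((x.1, v.1), x.2) + v.2 • ψ₂ x) =
          ∫ u in (0 : ℝ)..1, u ^ j * ℓ (δ ((x.1, (u : 𝕜) * x.2), (v.1, (u : 𝕜) * v.2))) := by
      rintro ⟨z, r⟩ ⟨hz, hr⟩ ⟨z', ρ⟩ ℓ
      have e₂ := h₂ z hz r hr (scaledDual ρ ℓ)
      rw [scaledDual_apply] at e₂
      rw [map_add, h₁ (z, z') ⟨hz, mem_univ _⟩ r hr ℓ, e₂, ← intervalIntegral.integral_add]
      · refine intervalIntegral.integral_congr fun u hu => ?_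
        rw [uIcc_of_le zero_le_one] at hu
        have hm : (z, (u : 𝕜) * r) ∈ N ×ˢ Metric.ball (0 : 𝕜) ε := ⟨hz, ofReal_mul_mem_ball hr hu⟩
        have e3 : ((z', (u : 𝕜) * ρ) : E × 𝕜) = (z', 0) + ((u : 𝕜) * ρ) • (0, 1) := by simp
        simp only [φ₁, φ₂, scaledDual_apply]
        rw [e3, hδadd hm, hδsmul _ hm, mul_smul, ofReal_smul, map_add, map_smul ℓ u, smul_eq_mul]
        ring
      · refine ContinuousOn.intervalIntegrable_of_Icc zero_le_one
          (continuousOn_radial (φ := φ₁) (N := N ×ˢ univ) (ε := ε) ?_ ⟨hz, mem_univ _⟩ hr ℓ)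
        exact hδ.continuousOn.comp (f := fun p : (E × E) × 𝕜 => ((p.1.1, p.2), (p.1.2, (0 : 𝕜))))
          (by fun_prop) fun p hp => ⟨⟨hp.1.1, hp.2⟩, mem_univ _⟩
      · refine ContinuousOn.intervalIntegrable_of_Icc zero_le_one
          (continuousOn_radial (φ := φ₂) (N := N) (ε := ε) ?_ hz hr (scaledDual ρ ℓ))
        exact hδ.continuousOn.comp (f := fun p : E × 𝕜 => (p, ((0 : E), (1 : 𝕜))))
          (by fun_prop) fun p hp => ⟨hp, mem_univ _⟩
    -- `Δ` is homogeneous and is the weak derivative of `ψ`, hence its derivative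
    refine ⟨h.continuousOn hN hφ hψ, _, fun x hx v =>
      hasDirDeriv_of_dual hD hΔ.continuousOn ?_ ?_ hx v, hΔ⟩
    · intro x hx v c
      refine eq_of_forall_dual_eq fun ℓ => ?_
      have := hΔℓ x hx v (scaledDual c ℓ)
      rw [scaledDual_apply] at this
      rw [hΔℓ x hx (c • v) ℓ, this]
      refine intervalIntegral.integral_congr fun u hu => ?_
      rw [uIcc_of_le zero_le_one] at hu
      have hm : (x.1, (u : 𝕜) * x.2) ∈ N ×ˢ Metric.ball (0 : 𝕜) ε :=
        ⟨hx.1, ofReal_mul_mem_ball hx.2 hu⟩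
      have e3 : (((c • v).1, (u : 𝕜) * (c • v).2) : E × 𝕜) = c • (v.1, (u : 𝕜) * v.2) := by
        simp [mul_left_comm]
      rw [e3, hδsmul _ hm, scaledDual_apply]
    · intro x hx v ℓ
      rw [hΔℓ x hx v ℓ]
      exact hder hx.1 hx.2 v ℓ

end AverageClass

/-! ### The extended slope of a map of class `Cⁿ⁺¹` -/

section SlopeClass

theorem isCBastiani_add_smul {n : ℕ} {E : Type u} [AddCommGroup E] [Module 𝕜 E]
    [TopologicalSpace E] {V : Type v} [AddCommGroup V] [Module 𝕜 V] [TopologicalSpace V]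
    [IsTopologicalAddGroup V] [ContinuousSMul 𝕜 V] (X Y : E →L[𝕜] V) (T : E →L[𝕜] 𝕜) (Ω : Set E) :
    IsCBastiani 𝕜 n Ω fun p => X p + T p • Y p :=
  (IsCBastiani.clm X Ω).add ((isCBastiani_smul n).comp_clm (T.prod Y) fun _ _ => mem_univ _)

variable {V : Type u} [AddCommGroup V] [Module 𝕜 V] [TopologicalSpace V]
  [IsTopologicalAddGroup V] [ContinuousSMul 𝕜 V]
  {W : Type v} [AddCommGroup W] [Module 𝕜 W] [TopologicalSpace W] [IsTopologicalAddGroup W]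
  [ContinuousSMul 𝕜 W] [Module ℝ W] [IsScalarTower ℝ 𝕜 W] [ContinuousSMul ℝ W]
  [LocallyConvexSpace ℝ W]

variable (𝕜 V) in
/-- The coordinate `v₀` on `V × V × 𝕜 × 𝕜`. -/
abbrev baseCLM : V × V × 𝕜 × 𝕜 →L[𝕜] V := .fst 𝕜 V (V × 𝕜 × 𝕜)

variable (𝕜 V) in
/-- The coordinate `v₁` on `V × V × 𝕜 × 𝕜`. -/
abbrev dirCLM : V × V × 𝕜 × 𝕜 →L[𝕜] V :=
  (ContinuousLinearMap.fst 𝕜 V (𝕜 × 𝕜)).comp (.snd 𝕜 V (V × 𝕜 × 𝕜))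

variable (𝕜 V) in
/-- The coordinate `t` on `V × V × 𝕜 × 𝕜`. -/
abbrev timeCLM : V × V × 𝕜 × 𝕜 →L[𝕜] 𝕜 :=
  (ContinuousLinearMap.fst 𝕜 𝕜 𝕜).comp
    ((ContinuousLinearMap.snd 𝕜 V (𝕜 × 𝕜)).comp (.snd 𝕜 V (V × 𝕜 × 𝕜)))

variable (𝕜 V) in
/-- The coordinate `s` on `V × V × 𝕜 × 𝕜`. -/
abbrev time'CLM : V × V × 𝕜 × 𝕜 →L[𝕜] 𝕜 :=
  (ContinuousLinearMap.snd 𝕜 𝕜 𝕜).comp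
    ((ContinuousLinearMap.snd 𝕜 V (𝕜 × 𝕜)).comp (.snd 𝕜 V (V × 𝕜 × 𝕜)))

theorem IsCBastiani.isC1 {n : ℕ} {U : Set V} {f : V → W} (h : IsCBastiani 𝕜 (n + 1) U f)
    (hU : IsOpen U) : IsC1 𝕜 U f := by
  obtain ⟨hf, δ, hd, hδ⟩ := h
  exact ⟨_, isSlopeExtension_completedSlope hU hf hd hδ.continuousOn⟩

theorem IsSlopeExtension.isCBastiani_of_ne {n : ℕ} {U : Set V} {f : V → W}
    {F : V × V × 𝕜 × 𝕜 → W} (hF : IsSlopeExtension 𝕜 U f F) (h : IsCBastiani 𝕜 n U f)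
    (hU : IsOpen U) : IsCBastiani 𝕜 n (slopeDomain 𝕜 U ∩ {p | p.2.2.1 ≠ p.2.2.2}) F := by
  have hopen : IsOpen (slopeDomain 𝕜 U ∩ {p | p.2.2.1 ≠ p.2.2.2}) :=
    (isOpen_slopeDomain hU).inter (isOpen_ne_fun (by fun_prop) (by fun_prop))
  have ht := h.comp hU (isCBastiani_add_smul (baseCLM 𝕜 V) (dirCLM 𝕜 V) (timeCLM 𝕜 V)
    (slopeDomain 𝕜 U ∩ {p | p.2.2.1 ≠ p.2.2.2})) fun p hp => hp.1.1
  have hs := h.comp hU (isCBastiani_add_smul (baseCLM 𝕜 V) (dirCLM 𝕜 V) (time'CLM 𝕜 V)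
    (slopeDomain 𝕜 U ∩ {p | p.2.2.1 ≠ p.2.2.2})) fun p hp => hp.1.2
  have hinv := (IsCBastiani.clm (n := n) (timeCLM 𝕜 V - time'CLM 𝕜 V)
    (slopeDomain 𝕜 U ∩ {p | p.2.2.1 ≠ p.2.2.2})).inv fun p hp => sub_ne_zero.2 hp.2
  exact (hinv.smul (ht.sub hs)).congr hopen fun p hp => (hF.2 _ _ _ _ hp.1 hp.2).symm

variable [T2Space W]

/-- In the coordinates `z = (v₀, v₁, s)` and `r = t - s`, the extended slope is near the diagonal
the average over `u ∈ [0, 1]` of `df (v₀ + (s + u r) v₁; v₁)`. -/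
theorem IsSlopeExtension.isRadialAverage {U : Set V} {f : V → W} {δ : V × V → W}
    {F : V × V × 𝕜 × 𝕜 → W} (hF : IsSlopeExtension 𝕜 U f F) (hU : IsOpen U)
    (hd : ∀ x ∈ U, ∀ v, HasDirDeriv 𝕜 f (δ (x, v)) x v) (hδ : ContinuousOn δ (U ×ˢ univ))
    {N : Set (V × V × 𝕜)} {ε : ℝ}
    (hNU : ∀ z ∈ N, ∀ r ∈ Metric.ball (0 : 𝕜) ε, z.1 + (z.2.2 + r) • z.2.1 ∈ U) :
    IsRadialAverage 0 N ε (fun p => δ (p.1.1 + (p.1.2.2 + p.2) • p.1.2.1, p.1.2.1))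
      (fun p => F (p.1.1, p.1.2.1, p.1.2.2 + p.2, p.1.2.2)) := by
  rintro ⟨a, b, s⟩ hz r hr ℓ
  have h0 : (0 : 𝕜) ∈ Metric.ball (0 : 𝕜) ε := Metric.mem_ball_self (Metric.pos_of_mem_ball hr)
  have hs : a + s • b ∈ U := by simpa using hNU _ hz 0 h0
  have hmem : (a, b, s + r, s) ∈ slopeDomain 𝕜 U := ⟨hNU _ hz r hr, hs⟩
  simp only
  rcases eq_or_ne r 0 with rfl | hr0
  · have hF' := (isSlopeExtension_completedSlope hU (hF.continuousOn hU) hd hδ).eqOn hU hF hmem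
    rw [← hF']
    simp [completedSlope]
  have key : ∀ u ∈ uIcc (0 : ℝ) 1, HasDerivAt
      (fun e : ℝ => scaledDual r⁻¹ ℓ (f (a + s • b + (e : 𝕜) • r • b)))
      (u ^ 0 * ℓ (δ (a + (s + (u : 𝕜) * r) • b, b))) u := by
    intro u hu
    rw [uIcc_of_le zero_le_one] at hu
    have hx : a + (s + (u : 𝕜) * r) • b = a + s • b + (u : 𝕜) • r • b := by module
    have h := (hd _ (hNU _ hz _ (ofReal_mul_mem_ball hr hu)) b).smul_dir r
    simp only at h
    rw [hx] at h ⊢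
    have h' := h.hasDerivAt_dual (scaledDual r⁻¹ ℓ)
    rwa [scaledDual_apply, smul_smul, inv_mul_cancel₀ hr0, one_smul, ← one_mul (ℓ _),
      ← pow_zero u] at h'
  have hcont : ContinuousOn (fun p : (V × V × 𝕜) × 𝕜 =>
      δ (p.1.1 + (p.1.2.2 + p.2) • p.1.2.1, p.1.2.1)) (N ×ˢ Metric.ball 0 ε) :=
    hδ.comp (by fun_prop) fun p hp => ⟨hNU _ hp.1 _ hp.2, mem_univ _⟩
  rw [intervalIntegral.integral_eq_sub_of_hasDerivAt key
    (ContinuousOn.intervalIntegrable_of_Icc zero_le_one (continuousOn_radial hcont hz hr ℓ)),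
    hF.2 _ _ _ _ hmem (by simpa using hr0)]
  simp [smul_sub, add_smul, add_assoc]

theorem IsCBastiani.slopeMap {n : ℕ} {U : Set V} {f : V → W} (h : IsCBastiani 𝕜 (n + 1) U f)
    (hU : IsOpen U) : IsCBastiani 𝕜 n (slopeDomain 𝕜 U) (slopeMap 𝕜 U f) := by
  have hF := (h.isC1 hU).isSlopeExtension
  have hne := hF.isCBastiani_of_ne h.of_succ hU
  obtain ⟨hf, δ, hd, hδ⟩ := h
  refine IsCBastiani.of_local (isOpen_slopeDomain hU) ?_
  rintro ⟨a, b, t, s⟩ ⟨hat, has⟩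
  by_cases hts : t = s
  swap
  · exact ⟨slopeDomain 𝕜 U ∩ {p | p.2.2.1 ≠ p.2.2.2},
      (isOpen_slopeDomain hU).inter (isOpen_ne_fun (by fun_prop) (by fun_prop)),
      ⟨⟨hat, has⟩, hts⟩, hne⟩
  -- near the diagonal, the segment between the two evaluation points lies in `U`
  have hc : ContinuousAt (fun p : (V × V × 𝕜) × 𝕜 => p.1.1 + (p.1.2.2 + p.2) • p.1.2.1)
      ((a, b, s), 0) := by fun_prop
  have hc' := hc.preimage_mem_nhds (hU.mem_nhds (by simpa using has))
  rw [nhds_prod_eq] at hc'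
  obtain ⟨A, hA, B, hB, hAB⟩ := mem_prod_iff.1 hc'
  obtain ⟨ε, hε, hball⟩ := Metric.mem_nhds_iff.1 hB
  have hNU : ∀ z ∈ interior A, ∀ r ∈ Metric.ball (0 : 𝕜) ε, z.1 + (z.2.2 + r) • z.2.1 ∈ U :=
    fun z hz r hr => hAB (mk_mem_prod (interior_subset hz) (hball hr))
  let p₀ : (V × V × 𝕜) × 𝕜 →L[𝕜] V := (ContinuousLinearMap.fst 𝕜 V (V × 𝕜)).comp (.fst 𝕜 _ 𝕜)
  let p₁ : (V × V × 𝕜) × 𝕜 →L[𝕜] V := (ContinuousLinearMap.fst 𝕜 V 𝕜).comp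
    ((ContinuousLinearMap.snd 𝕜 V (V × 𝕜)).comp (.fst 𝕜 _ 𝕜))
  let pₛ : (V × V × 𝕜) × 𝕜 →L[𝕜] 𝕜 := (ContinuousLinearMap.snd 𝕜 V 𝕜).comp
    ((ContinuousLinearMap.snd 𝕜 V (V × 𝕜)).comp (.fst 𝕜 _ 𝕜))
  let pᵣ : (V × V × 𝕜) × 𝕜 →L[𝕜] 𝕜 := .snd 𝕜 _ 𝕜
  have hψ := (hF.isRadialAverage hU hd hδ.continuousOn hNU).isCBastiani (m := n) isOpen_interior
    (hδ.comp (hU.prod isOpen_univ) ((isCBastiani_add_smul p₀ p₁ (pₛ + pᵣ) _).prodMk (.clm p₁ _))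
      fun p hp => ⟨hNU _ hp.1 _ hp.2, mem_univ _⟩)
    (hne.comp_clm (p₀.prod (p₁.prod ((pₛ + pᵣ).prod pₛ))) fun p hp =>
      ⟨⟨hNU _ hp.1 _ hp.2.1, by
        simpa [p₀, p₁, pₛ] using hNU _ hp.1 0 (Metric.mem_ball_self hε)⟩,
      by simpa [p₀, p₁, pₛ, pᵣ] using hp.2.2⟩)
  let L : V × V × 𝕜 × 𝕜 →L[𝕜] (V × V × 𝕜) × 𝕜 :=
    ((baseCLM 𝕜 V).prod ((dirCLM 𝕜 V).prod (time'CLM 𝕜 V))).prod (timeCLM 𝕜 V - time'CLM 𝕜 V)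
  have hO : IsOpen (L ⁻¹' (interior A ×ˢ Metric.ball 0 ε)) :=
    (isOpen_interior.prod Metric.isOpen_ball).preimage L.continuous
  refine ⟨_, hO, ⟨?_, ?_⟩, (hψ.comp_clm L fun p hp => hp).congr hO fun p _ => ?_⟩
  · simpa [L] using mem_interior_iff_mem_nhds.2 hA
  · simpa [L, hts] using hε
  · simp [L]

end SlopeClass

/-! ### Full iteration -/

theorem IsCFull.isCBastiani {n : ℕ} : ∀ {V : Type u} {W : Type v} [AddCommGroup V] [Module 𝕜 V]
    [TopologicalSpace V] [IsTopologicalAddGroup V] [ContinuousSMul 𝕜 V]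
    [AddCommGroup W] [Module 𝕜 W] [TopologicalSpace W] [IsTopologicalAddGroup W]
    {U : Set V} {f : V → W}, IsOpen U → IsCFull 𝕜 n U f → IsCBastiani 𝕜 n U f := by
  induction n with
  | zero => intro V W _ _ _ _ _ _ _ _ _ U f _ h; exact h
  | succ n ih =>
    rintro V W _ _ _ _ _ _ _ _ _ U f hU ⟨hC, h⟩
    have hF := hC.isSlopeExtension
    exact ⟨hF.continuousOn hU, fun p => slopeMap 𝕜 U f (p.1, p.2, 0, 0),
      fun x hx v => hF.hasDirDeriv hU hx v,
      (ih (isOpen_slopeDomain hU) h).comp_clm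
        ((ContinuousLinearMap.fst 𝕜 V V).prod ((ContinuousLinearMap.snd 𝕜 V V).prod 0))
        fun p hp => by simpa [slopeDomain] using hp⟩

theorem IsCBastiani.isCFull {n : ℕ} : ∀ {V : Type u} {W : Type v} [AddCommGroup V] [Module 𝕜 V]
    [TopologicalSpace V] [IsTopologicalAddGroup V] [ContinuousSMul 𝕜 V]
    [AddCommGroup W] [Module 𝕜 W] [TopologicalSpace W] [IsTopologicalAddGroup W]
    [ContinuousSMul 𝕜 W] [Module ℝ W] [IsScalarTower ℝ 𝕜 W] [ContinuousSMul ℝ W]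
    [LocallyConvexSpace ℝ W] [T2Space W]
    {U : Set V} {f : V → W}, IsOpen U → IsCBastiani 𝕜 n U f → IsCFull 𝕜 n U f := by
  induction n with
  | zero => intro V W _ _ _ _ _ _ _ _ _ _ _ _ _ _ _ U f _ h; exact h
  | succ n ih =>
    intro V W _ _ _ _ _ _ _ _ _ _ _ _ _ _ _ U f hU h
    exact ⟨h.isC1 hU, ih (isOpen_slopeDomain hU) (h.slopeMap hU)⟩

/-! ### Keller's classes -/

theorem IsCBastiani.isCKeller {n : ℕ} : ∀ {V : Type u} {W : Type v} [AddCommGroup V] [Module 𝕜 V]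
    [TopologicalSpace V] [AddCommGroup W] [Module 𝕜 W] [TopologicalSpace W]
    {U : Set V} {f : V → W}, IsCBastiani 𝕜 n U f → IsCKeller 𝕜 n U f := by
  induction n with
  | zero =>
    intro V W _ _ _ _ _ _ U f h
    refine ⟨fun _ x _ => f x, fun _ _ => rfl, fun k hk => absurd hk (Nat.not_lt_zero k), ?_⟩
    intro k _
    exact ContinuousOn.comp h continuousOn_fst fun p hp => hp.1
  | succ n ih =>
    rintro V W _ _ _ _ _ _ U f ⟨hf, δ, hd, hδ⟩
    obtain ⟨D, hD0, hDd, hDc⟩ := ih hδ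
    -- `dᵏ⁺¹f (x; v₀, …, v_k)` is `dᵏ(df) ((x, v₀); (v₁, 0), …, (v_k, 0))`
    refine ⟨fun k => match k with
      | 0 => fun x _ => f x
      | k + 1 => fun x v => D k (x, v 0) fun i => (v i.succ, 0), fun _ _ => rfl, ?_, ?_⟩
    · rintro (_ | k) hk x hx v w
      · have h0 : (fun i : Fin 0 => ((Fin.snoc v w : Fin 1 → V) i.succ, (0 : V))) = Fin.elim0 :=
          funext fun i => i.elim0
        have hv : (Fin.snoc v w : Fin 1 → V) 0 = w := Fin.snoc_last (α := fun _ => V) w v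
        simp only
        rw [h0, hv, hD0 (x, w) ⟨hx, mem_univ _⟩]
        exact hd x hx w
      · have hs : (fun i : Fin (k + 1) => ((Fin.snoc v w : Fin (k + 2) → V) i.succ, (0 : V))) =
            Fin.snoc (fun i : Fin k => (v i.succ, (0 : V))) (w, 0) := by
          funext i
          refine Fin.lastCases ?_ (fun i => ?_) i
          · simp [Fin.succ_last]
          · rw [Fin.snoc_castSucc, Fin.succ_castSucc, Fin.snoc_castSucc]
        have hv : (Fin.snoc v w : Fin (k + 2) → V) 0 = v 0 :=
          Fin.snoc_castSucc (α := fun _ => V) (x := w) (p := v) (i := 0)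
        simp only
        rw [hs, hv]
        have := hDd k (Nat.lt_of_succ_lt_succ hk) (x, v 0) ⟨hx, mem_univ _⟩
          (fun i => (v i.succ, 0)) (w, 0)
        simpa [HasDirDeriv] using this
    · rintro (_ | k) hk
      · exact hf.comp continuousOn_fst fun p hp => hp.1
      · exact (hDc k (Nat.le_of_succ_le_succ hk)).comp
          (f := fun p : V × (Fin (k + 1) → V) =>
            ((p.1, p.2 0), fun i : Fin k => (p.2 i.succ, (0 : V))))
          (by fun_prop) fun p hp => ⟨⟨hp.1, mem_univ _⟩, mem_univ _⟩

section Keller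

variable {V : Type u} {W : Type v} [AddCommGroup V] [Module 𝕜 V]
    [TopologicalSpace V] [IsTopologicalAddGroup V] [ContinuousSMul 𝕜 V]
    [AddCommGroup W] [Module 𝕜 W] [TopologicalSpace W] [IsTopologicalAddGroup W]
    [ContinuousSMul 𝕜 W] [Module ℝ W] [IsScalarTower ℝ 𝕜 W] [ContinuousSMul ℝ W]
    [LocallyConvexSpace ℝ W] [T2Space W]

/-- The iterated directional derivatives of a map of Keller's class `Cⁿ_c` are multilinear. -/
theorem map_update_of_keller {n : ℕ} {U : Set V} (hU : IsOpen U)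
    {d : (k : ℕ) → V → (Fin k → V) → W}
    (hd : ∀ k < n, ∀ x ∈ U, ∀ (v : Fin k → V) (w : V),
      HasDirDeriv 𝕜 (fun y => d k y v) (d (k + 1) x (Fin.snoc v w)) x w)
    (hc : ∀ k ≤ n, ContinuousOn (fun p : V × (Fin k → V) => d k p.1 p.2) (U ×ˢ univ)) :
    ∀ k ≤ n, ∀ x ∈ U, ∀ (v : Fin k → V) (i : Fin k),
      (∀ a b, d k x (Function.update v i (a + b)) =
        d k x (Function.update v i a) + d k x (Function.update v i b)) ∧
      ∀ (c : 𝕜) a, d k x (Function.update v i (c • a)) = c • d k x (Function.update v i a) := by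
  intro k
  induction k with
  | zero => intro _ x _ v i; exact i.elim0
  | succ k ih =>
    intro hk x hx v i
    have hk' : k < n := hk
    induction v using Fin.snocCases with | snoc v w => ?_
    refine Fin.lastCases ?_ (fun i => ?_) i
    · simp only [Fin.update_snoc_last]
      refine ⟨fun a b => ?_, fun c a => ?_⟩
      · refine (hd k hk' x hx v (a + b)).unique (HasDirDeriv.add_dir
          (δ := fun y => d (k + 1) y (Fin.snoc v a)) ?_ ?_ (hd k hk' x hx v b))
        · filter_upwards [hU.mem_nhds hx] with y hy using hd k hk' y hy v a
        · exact ContinuousAt.comp (g := fun p : V × (Fin (k + 1) → V) => d (k + 1) p.1 p.2)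
            ((hc (k + 1) hk).continuousAt ((hU.prod isOpen_univ).mem_nhds ⟨hx, mem_univ _⟩))
            (f := fun y => (y, (Fin.snoc v a : Fin (k + 1) → V))) (by fun_prop)
      · exact (hd k hk' x hx v (c • a)).unique ((hd k hk' x hx v a).smul_dir c)
    · simp only [← Fin.snoc_update]
      refine ⟨fun a b => ?_, fun c a => ?_⟩
      · refine (hd k hk' x hx _ w).unique (HasDirDeriv.congr_of_eqOn hU (fun y hy => ?_) hx
          ((hd k hk' x hx _ w).add (hd k hk' x hx _ w)))
        exact ((ih hk'.le y hy v i).1 a b).symm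
      · refine (hd k hk' x hx _ w).unique (HasDirDeriv.congr_of_eqOn hU (fun y hy => ?_) hx
          ((hd k hk' x hx _ w).const_smul c))
        exact ((ih hk'.le y hy v i).2 c a).symm

/-- If `f` is of Keller's class `Cⁿ_c`, then `dᵏf : U × Vᵏ → W` is of Bastiani's class `Cᵐ` for
`k + m ≤ n`: its derivative at `(x, v)` in the direction `(a, b)` is
`dᵏ⁺¹f (x; v, a) + ∑ᵢ dᵏf (x; v₁, …, bᵢ, …, v_k)`. -/
theorem isCBastiani_of_keller {n : ℕ} {U : Set V} (hU : IsOpen U)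
    {d : (k : ℕ) → V → (Fin k → V) → W}
    (hd : ∀ k < n, ∀ x ∈ U, ∀ (v : Fin k → V) (w : V),
      HasDirDeriv 𝕜 (fun y => d k y v) (d (k + 1) x (Fin.snoc v w)) x w)
    (hc : ∀ k ≤ n, ContinuousOn (fun p : V × (Fin k → V) => d k p.1 p.2) (U ×ˢ univ)) (m : ℕ) :
    ∀ k, k + m ≤ n →
      IsCBastiani 𝕜 m (U ×ˢ univ) (fun p : V × (Fin k → V) => d k p.1 p.2) := by
  induction m with
  | zero => intro k hk; exact hc k hk
  | succ m ih =>
    intro k hk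
    have hk' : k < n := by omega
    have hUo : IsOpen (U ×ˢ (univ : Set (Fin k → V))) := hU.prod isOpen_univ
    let L₀ : (V × (Fin k → V)) × (V × (Fin k → V)) →L[𝕜] V × (Fin (k + 1) → V) :=
      { toFun := fun p => (p.1.1, Fin.snoc p.1.2 p.2.1)
        map_add' := fun p q => by
          refine Prod.ext rfl (funext fun i => ?_)
          refine Fin.lastCases ?_ (fun i => ?_) i <;> simp
        map_smul' := fun c p => by
          refine Prod.ext rfl (funext fun i => ?_)
          refine Fin.lastCases ?_ (fun i => ?_) i <;> simp
        cont := by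
          refine Continuous.prodMk (by fun_prop) ?_
          exact Continuous.finSnoc (by fun_prop) (by fun_prop) }
    let L (i : Fin k) : (V × (Fin k → V)) × (V × (Fin k → V)) →L[𝕜] V × (Fin k → V) :=
      { toFun := fun p => (p.1.1, Function.update p.1.2 i (p.2.2 i))
        map_add' := fun p q => by
          refine Prod.ext rfl (funext fun j => ?_)
          rcases eq_or_ne j i with rfl | hj <;> simp [*]
        map_smul' := fun c p => by
          refine Prod.ext rfl (funext fun j => ?_)
          rcases eq_or_ne j i with rfl | hj <;> simp [*]
        cont := by
          refine Continuous.prodMk (by fun_prop) ?_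
          exact Continuous.update (by fun_prop) i (by fun_prop) }
    have h0 : IsCBastiani 𝕜 m ((U ×ˢ (univ : Set (Fin k → V))) ×ˢ univ)
        fun q : (V × (Fin k → V)) × (V × (Fin k → V)) => d (k + 1) q.1.1 (Fin.snoc q.1.2 q.2.1) :=
      (ih (k + 1) (by omega)).comp_clm L₀ fun p hp => ⟨hp.1.1, mem_univ _⟩
    have h1 : ∀ i, IsCBastiani 𝕜 m ((U ×ˢ (univ : Set (Fin k → V))) ×ˢ univ)
        fun q : (V × (Fin k → V)) × (V × (Fin k → V)) =>
          d k q.1.1 (Function.update q.1.2 i (q.2.2 i)) := fun i =>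
      (ih k (by omega)).comp_clm (L i) fun p hp => ⟨hp.1.1, mem_univ _⟩
    refine ⟨hc k hk'.le, _, ?_, h0.add (IsCBastiani.sum Finset.univ h1)⟩
    rintro ⟨x, v⟩ ⟨hx, -⟩ ⟨a, b⟩
    simp only at hx
    -- differentiate in the base point and in one direction at a time
    have hdir : ((a, b) : V × (Fin k → V)) = (a, 0) + ∑ i, (0, Pi.single i (b i)) := by
      refine Prod.ext ?_ ?_
      · simp [Prod.fst_sum]
      · simp [Prod.snd_sum, Finset.univ_sum_single]
    suffices key : HasDirDeriv 𝕜 (fun p : V × (Fin k → V) => d k p.1 p.2)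
        (d (k + 1) x (Fin.snoc v a) + ∑ i, d k x (Function.update v i (b i))) (x, v)
        ((a, 0) + ∑ i, (0, Pi.single i (b i))) by
      rw [← hdir] at key
      exact key
    refine HasDirDeriv.add_dir (f := fun p : V × (Fin k → V) => d k p.1 p.2) (x := (x, v))
      (v := (a, 0)) (v' := ∑ i, (0, Pi.single i (b i)))
      (δ := fun p : V × (Fin k → V) => d (k + 1) p.1 (Fin.snoc p.2 a))
      ?_ ?_ (HasDirDeriv.sum_dir (f := fun p : V × (Fin k → V) => d k p.1 p.2) Finset.univ
        (x := (x, v)) (v := fun i => (0, Pi.single i (b i)))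
        (δ := fun i (p : V × (Fin k → V)) => d k p.1 (Function.update p.2 i (b i))) ?_ ?_)
    · filter_upwards [hUo.mem_nhds (show (x, v) ∈ _ from ⟨hx, mem_univ _⟩)] with p hp
      have := hd k hk' p.1 hp.1 p.2 a
      simpa [HasDirDeriv] using this
    · refine ContinuousAt.comp (g := fun p : V × (Fin (k + 1) → V) => d (k + 1) p.1 p.2)
        (f := fun p : V × (Fin k → V) => (p.1, (Fin.snoc p.2 a : Fin (k + 1) → V)))
        ((hc (k + 1) hk').continuousAt ((hU.prod isOpen_univ).mem_nhds ⟨hx, mem_univ _⟩)) ?_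
      refine (Continuous.prodMk (by fun_prop) ?_).continuousAt
      exact Continuous.finSnoc (by fun_prop) (by fun_prop)
    · intro i
      filter_upwards [hUo.mem_nhds (show (x, v) ∈ _ from ⟨hx, mem_univ _⟩)] with p hp
      refine tendsto_const_nhds.congr' ?_
      filter_upwards [self_mem_nhdsWithin] with t ht
      have ht : t ≠ 0 := ht
      have hupd : p.2 + t • (Pi.single i (b i) : Fin k → V) =
          Function.update p.2 i (p.2 i + t • b i) := by
        funext j
        rcases eq_or_ne j i with rfl | hj <;> simp [*]
      have hlin := map_update_of_keller hU hd hc k hk'.le p.1 hp.1 p.2 i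
      rw [eq_inv_smul_iff₀ ht]
      simp only [Prod.fst_add, Prod.snd_add, Prod.smul_mk, smul_zero, add_zero]
      rw [hupd, hlin.1, hlin.2, Function.update_eq_self, add_sub_cancel_left]
    · intro i
      refine ContinuousAt.comp (g := fun p : V × (Fin k → V) => d k p.1 p.2)
        (f := fun p : V × (Fin k → V) => (p.1, Function.update p.2 i (b i)))
        ((hc k hk'.le).continuousAt (hUo.mem_nhds ⟨hx, mem_univ _⟩)) ?_
      refine (Continuous.prodMk (by fun_prop) ?_).continuousAt
      exact Continuous.update (by fun_prop) i (by fun_prop)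

theorem IsCKeller.isCBastiani {n : ℕ} {U : Set V} {f : V → W} (hU : IsOpen U)
    (h : IsCKeller 𝕜 n U f) : IsCBastiani 𝕜 n U f := by
  obtain ⟨d, hd0, hd, hc⟩ := h
  refine ((isCBastiani_of_keller hU hd hc n 0 (by omega)).comp_clm
    (ContinuousLinearMap.prod (.id 𝕜 V) 0) fun x hx => ⟨hx, mem_univ _⟩).congr hU fun x hx => ?_
  rw [← hd0 x hx]
  exact congrArg (d 0 x) (Subsingleton.elim _ _)

end Keller

/-! ### Restricted iteration -/

theorem IsCRestricted.isCBastiani {n : ℕ} : ∀ {V : Type u} {W : Type v} [AddCommGroup V]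
    [Module 𝕜 V] [TopologicalSpace V] [IsTopologicalAddGroup V] [ContinuousSMul 𝕜 V]
    [AddCommGroup W] [Module 𝕜 W] [TopologicalSpace W] [IsTopologicalAddGroup W]
    {U : Set V} {f : V → W}, IsOpen U → IsCRestricted 𝕜 n U f → IsCBastiani 𝕜 n U f := by
  induction n with
  | zero => intro V W _ _ _ _ _ _ _ _ _ U f _ h; exact h
  | succ n ih =>
    rintro V W _ _ _ _ _ _ _ _ _ U f hU ⟨hC, h, -⟩
    have hF := hC.isSlopeExtension
    refine ⟨hF.continuousOn hU, fun p => slopeMap 𝕜 U f (p.1, p.2, 0, 0),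
      fun x hx v => hF.hasDirDeriv hU hx v, ?_⟩
    exact ((ih (isOpen_frozenDomain hU 0 0) (h 0 0)).mono
      fun p hp => by simpa [frozenDomain] using hp.1).clm_comp (ContinuousLinearMap.snd 𝕜 W W)

theorem frozenMap_congr {V : Type u} {W : Type v} [AddCommGroup V] [Module 𝕜 V]
    [TopologicalSpace V] [AddCommGroup W] [Module 𝕜 W] [TopologicalSpace W]
    {U : Set V} {f g : V → W} (h : EqOn f g U) (t s : 𝕜) :
    EqOn (frozenMap U f t s) (frozenMap U g t s) (frozenDomain U t s) := by
  intro p hp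
  simp only [frozenMap]
  rw [slopeMap_congr h, h hp.1]

theorem iterMap_congr {n : ℕ} : ∀ {V : Type u} {W : Type v} [AddCommGroup V] [Module 𝕜 V]
    [TopologicalSpace V] [AddCommGroup W] [Module 𝕜 W] [TopologicalSpace W]
    {U : Set V} {f g : V → W}, EqOn f g U → ∀ t s : Fin n → 𝕜,
    EqOn (iterMap n U f t s) (iterMap n U g t s) (iterDomain n U t s) := by
  induction n with
  | zero => intro V W _ _ _ _ _ _ U f g h t s; exact h
  | succ n ih =>
    intro V W _ _ _ _ _ _ U f g h t s
    exact ih (frozenMap_congr h _ _) _ _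

section Parameters

/-- The domain `U_{(t,s)}`, for a set `U` depending on a parameter in `P`, as a set with parameter
`(p, t, s)`. -/
def paramDomain {P : Type} {V : Type u} [AddCommGroup V] [Module 𝕜 V] (Ω : Set (P × V)) :
    Set ((P × 𝕜 × 𝕜) × (V × V)) :=
  {q | (q.1.1, q.2.1 + q.1.2.1 • q.2.2) ∈ Ω ∧ (q.1.1, q.2.1 + q.1.2.2 • q.2.2) ∈ Ω}

theorem isOpen_paramDomain {P : Type} [TopologicalSpace P] {V : Type u} [AddCommGroup V]
    [Module 𝕜 V] [TopologicalSpace V] [IsTopologicalAddGroup V] [ContinuousSMul 𝕜 V]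
    {Ω : Set (P × V)} (hΩ : IsOpen Ω) : IsOpen (paramDomain (𝕜 := 𝕜) Ω) := by
  refine IsOpen.inter (hΩ.preimage ?_) (hΩ.preimage ?_) <;> fun_prop

variable {P : Type} [AddCommGroup P] [Module 𝕜 P] [TopologicalSpace P]
  {V : Type u} [AddCommGroup V] [Module 𝕜 V] [TopologicalSpace V] [IsTopologicalAddGroup V]
  [ContinuousSMul 𝕜 V]
  {W : Type v} [AddCommGroup W] [Module 𝕜 W] [TopologicalSpace W]

/-- The map `f_{(t,s)}`, for a map `f` depending on a parameter in `P`, as a map with parameter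
`(p, t, s)`. Its slope is that of the joint map in the directions `(0, v₁)`. -/
noncomputable def paramMap (Ω : Set (P × V)) (f : P × V → W) (q : (P × 𝕜 × 𝕜) × (V × V)) : W × W :=
  (f (q.1.1, q.2.1 + q.1.2.1 • q.2.2) -
      q.1.2.1 • slopeMap 𝕜 Ω f ((q.1.1, q.2.1), (0, q.2.2), q.1.2.1, q.1.2.2),
    slopeMap 𝕜 Ω f ((q.1.1, q.2.1), (0, q.2.2), q.1.2.1, q.1.2.2))

theorem frozenMap_eqOn_paramMap [T2Space W] {Ω : Set (P × V)} (hΩ : IsOpen Ω) {f : P × V → W}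
    (h : IsC1 𝕜 Ω f) (p : P) (t s : 𝕜) :
    EqOn (frozenMap {v | (p, v) ∈ Ω} (fun v => f (p, v)) t s)
      (fun w => paramMap Ω f ((p, t, s), w)) (frozenDomain {v | (p, v) ∈ Ω} t s) := by
  have hΩp : IsOpen {v | (p, v) ∈ Ω} := hΩ.preimage (by fun_prop)
  have hF := h.isSlopeExtension
  have hG : IsSlopeExtension 𝕜 {v | (p, v) ∈ Ω} (fun v => f (p, v)) fun q =>
      slopeMap 𝕜 Ω f ((p, q.1), (0, q.2.1), q.2.2.1, q.2.2.2) := by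
    refine ⟨hF.1.comp (by fun_prop) fun q hq => ?_, fun v₀ v₁ t s hq hts => ?_⟩
    · simpa [slopeDomain] using hq
    · beta_reduce
      rw [hF.2 (p, v₀) (0, v₁) t s (by simpa [slopeDomain] using hq) hts]
      simp
  have heq := (IsC1.isSlopeExtension ⟨_, hG⟩).eqOn hΩp hG
  rintro ⟨v₀, v₁⟩ hw
  have := heq (show (v₀, v₁, t, s) ∈ slopeDomain 𝕜 {v | (p, v) ∈ Ω} from hw)
  simp only [frozenMap, paramMap, this]

variable [IsTopologicalAddGroup P] [ContinuousSMul 𝕜 P] [IsTopologicalAddGroup W]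
  [ContinuousSMul 𝕜 W] [Module ℝ W] [IsScalarTower ℝ 𝕜 W] [ContinuousSMul ℝ W]
  [LocallyConvexSpace ℝ W] [T2Space W]

theorem IsCBastiani.paramMap {n : ℕ} {Ω : Set (P × V)} (hΩ : IsOpen Ω) {f : P × V → W}
    (h : IsCBastiani 𝕜 (n + 1) Ω f) :
    IsCBastiani 𝕜 n (paramDomain (𝕜 := 𝕜) Ω) (paramMap Ω f) := by
  let pP : (P × 𝕜 × 𝕜) × (V × V) →L[𝕜] P := (ContinuousLinearMap.fst 𝕜 P (𝕜 × 𝕜)).comp (.fst 𝕜 _ _)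
  let pt : (P × 𝕜 × 𝕜) × (V × V) →L[𝕜] 𝕜 := (ContinuousLinearMap.fst 𝕜 𝕜 𝕜).comp
    ((ContinuousLinearMap.snd 𝕜 P (𝕜 × 𝕜)).comp (.fst 𝕜 _ _))
  let ps : (P × 𝕜 × 𝕜) × (V × V) →L[𝕜] 𝕜 := (ContinuousLinearMap.snd 𝕜 𝕜 𝕜).comp
    ((ContinuousLinearMap.snd 𝕜 P (𝕜 × 𝕜)).comp (.fst 𝕜 _ _))
  let p₀ : (P × 𝕜 × 𝕜) × (V × V) →L[𝕜] V := (ContinuousLinearMap.fst 𝕜 V V).comp (.snd 𝕜 _ _)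
  let p₁ : (P × 𝕜 × 𝕜) × (V × V) →L[𝕜] V := (ContinuousLinearMap.snd 𝕜 V V).comp (.snd 𝕜 _ _)
  have hS := (h.slopeMap hΩ).comp_clm (Ω := paramDomain Ω)
    ((pP.prod p₀).prod ((ContinuousLinearMap.prod 0 p₁).prod (pt.prod ps)))
    fun q hq => by simpa [slopeDomain, paramDomain, pP, pt, ps, p₀, p₁] using hq
  have hf := h.of_succ.comp hΩ ((IsCBastiani.clm pP (paramDomain (𝕜 := 𝕜) Ω)).prodMk
    (isCBastiani_add_smul p₀ p₁ pt _)) fun q hq => hq.1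
  exact (hf.sub ((IsCBastiani.clm pt _).smul hS)).prodMk hS

end Parameters

/-- For maps of class `Cⁿ` depending on a parameter, the `n`-fold iterated map is jointly continuous
in the parameter, the space variables and the time variables. -/
theorem IsCBastiani.continuousOn_iterMap {n : ℕ} : ∀ {P : Type} {V : Type u} {W : Type v}
    [AddCommGroup P] [Module 𝕜 P] [TopologicalSpace P] [IsTopologicalAddGroup P]
    [ContinuousSMul 𝕜 P] [AddCommGroup V] [Module 𝕜 V] [TopologicalSpace V]
    [IsTopologicalAddGroup V] [ContinuousSMul 𝕜 V]
    [AddCommGroup W] [Module 𝕜 W] [TopologicalSpace W] [IsTopologicalAddGroup W]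
    [ContinuousSMul 𝕜 W] [Module ℝ W] [IsScalarTower ℝ 𝕜 W] [ContinuousSMul ℝ W]
    [LocallyConvexSpace ℝ W] [T2Space W] {Ω : Set (P × V)} {f : P × V → W},
    IsOpen Ω → IsCBastiani 𝕜 n Ω f →
    ContinuousOn (fun q : P × Iter V n × (Fin n → 𝕜) × (Fin n → 𝕜) =>
      iterMap n {v | (q.1, v) ∈ Ω} (fun v => f (q.1, v)) q.2.2.1 q.2.2.2 q.2.1)
      {q | q.2.1 ∈ iterDomain n {v | (q.1, v) ∈ Ω} q.2.2.1 q.2.2.2} := by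
  induction n with
  | zero =>
    intro P V W _ _ _ _ _ _ _ _ _ _ _ _ _ _ _ _ _ _ _ _ Ω f _ h
    exact ContinuousOn.comp (f := fun q : P × V × (Fin 0 → 𝕜) × (Fin 0 → 𝕜) => (q.1, q.2.1)) h
      (by fun_prop) fun q hq => hq
  | succ n ih =>
    intro P V W _ _ _ _ _ _ _ _ _ _ _ _ _ _ _ _ _ _ _ _ Ω f hΩ h
    have key := ih (isOpen_paramDomain hΩ) (h.paramMap hΩ)
    have hcont : Continuous fun q : P × Iter (V × V) n × (Fin (n + 1) → 𝕜) × (Fin (n + 1) → 𝕜) =>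
        ((q.1, q.2.2.1 0, q.2.2.2 0), q.2.1, Fin.tail q.2.2.1, Fin.tail q.2.2.2) := by
      have : Continuous fun t : Fin (n + 1) → 𝕜 => Fin.tail t :=
        continuous_pi fun i => continuous_apply i.succ
      fun_prop
    refine (key.comp hcont.continuousOn fun q hq => hq).congr fun q hq => ?_
    exact iterMap_congr (frozenMap_eqOn_paramMap hΩ (h.isC1 hΩ) q.1 (q.2.2.1 0) (q.2.2.2 0)) _ _ hq

theorem IsCBastiani.isCRestricted {n : ℕ} : ∀ {V : Type u} {W : Type v} [AddCommGroup V]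
    [Module 𝕜 V] [TopologicalSpace V] [IsTopologicalAddGroup V] [ContinuousSMul 𝕜 V]
    [AddCommGroup W] [Module 𝕜 W] [TopologicalSpace W] [IsTopologicalAddGroup W]
    [ContinuousSMul 𝕜 W] [Module ℝ W] [IsScalarTower ℝ 𝕜 W] [ContinuousSMul ℝ W]
    [LocallyConvexSpace ℝ W] [T2Space W]
    {U : Set V} {f : V → W}, IsOpen U → IsCBastiani 𝕜 n U f → IsCRestricted 𝕜 n U f := by
  induction n with
  | zero => intro V W _ _ _ _ _ _ _ _ _ _ _ _ _ _ _ U f _ h; exact h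
  | succ n ih =>
    intro V W _ _ _ _ _ _ _ _ _ _ _ _ _ _ _ U f hU h
    -- `f` as a map with a trivial parameter
    have hΩ : IsOpen {p : PUnit.{1} × V | p.2 ∈ U} := hU.preimage continuous_snd
    have h' : IsCBastiani 𝕜 (n + 1) {p : PUnit.{1} × V | p.2 ∈ U} fun p => f p.2 :=
      h.comp_clm (ContinuousLinearMap.snd 𝕜 PUnit V) fun p hp => hp
    refine ⟨h.isC1 hU, fun t s => ih (isOpen_frozenDomain hU t s) ?_, ?_⟩
    · have hmap : IsCBastiani 𝕜 n (frozenDomain U t s) fun q : V × V =>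
          ((PUnit.unit.{1}, t, s), q) :=
        (IsCBastiani.const n _ _).prodMk (.clm (ContinuousLinearMap.id 𝕜 (V × V)) _)
      refine ((h'.paramMap hΩ).comp (isOpen_paramDomain hΩ) hmap fun q hq => hq).congr
        (isOpen_frozenDomain hU t s) fun q hq => ?_
      exact (frozenMap_eqOn_paramMap hΩ (h'.isC1 hΩ) PUnit.unit t s hq).symm
    · exact (h'.continuousOn_iterMap hΩ).comp
        (f := fun p : Iter V (n + 1) × (Fin (n + 1) → 𝕜) × (Fin (n + 1) → 𝕜) => (PUnit.unit, p))
        (by fun_prop) fun p hp => hp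

end DiffCalc

theorem mainTheorem12 {𝕜 : Type} [RCLike 𝕜] {V : Type u} {V' : Type v}
    [AddCommGroup V] [Module 𝕜 V] [TopologicalSpace V] [IsTopologicalAddGroup V]
    [ContinuousSMul 𝕜 V] [Module ℝ V] [IsScalarTower ℝ 𝕜 V] [LocallyConvexSpace ℝ V]
    [AddCommGroup V'] [Module 𝕜 V'] [TopologicalSpace V'] [IsTopologicalAddGroup V']
    [ContinuousSMul 𝕜 V'] [Module ℝ V'] [IsScalarTower ℝ 𝕜 V'] [LocallyConvexSpace ℝ V']
    [T2Space V']
    (n : ℕ) (U : Set V) (hU : IsOpen U) (f : V → V') :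
    (DiffCalc.IsCFull 𝕜 n U f ↔ DiffCalc.IsCKeller 𝕜 n U f) ∧
      (DiffCalc.IsCRestricted 𝕜 n U f ↔ DiffCalc.IsCKeller 𝕜 n U f) := by
  have : ContinuousSMul ℝ V' := IsScalarTower.continuousSMul 𝕜
  exact ⟨⟨fun h => (h.isCBastiani hU).isCKeller, fun h => (h.isCBastiani hU).isCFull hU⟩,
    ⟨fun h => (h.isCBastiani hU).isCKeller, fun h => (h.isCBastiani hU).isCRestricted hU⟩⟩
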